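/- Let $X_N^{(k)}$ be an affine Dynkin diagram with vertices $0,\dots,n$, numbered as in Kac's tables Aff 1–3, with generalized Cartan matrix $(a_{ij})$, labels $a_0,\dots,a_n$ and dual labels $a_0^\vee,\dots,a_n^\vee$. Let $\widehat{\mathfrak h}_{\mathbb R}^*$ be the real vector space with basis $\alpha_0,\dots,\alpha_n,\omega_0$ and with the symmetric bilinear form given by $(\alpha_i,\alpha_j)=\frac{a_i^\vee}{a_i}a_{ij}$, $(\omega_0,\alpha_0)=\frac12(\alpha_0,\alpha_0)$, $(\omega_0,\alpha_i)=0$ for $i\ge1$, and $(\omega_0,\omega_0)=0$. For a non-isotropic $\alpha$ let $s_\alpha$ be the orthogonal reflection in $\alpha$. Put $\widehat W=\langle s_{\alpha_0},\dots,s_{\alpha_n}\rangle$, $\Pi_f=\{\alpha_1,\dots,\alpha_n\}$, $W_f=\langle s_{\alpha_1},\dots,s_{\alpha_n}\rangle$, $\delta=\sum_{i=0}^n a_i\alpha_i$ and $\theta=\delta-a_0\alpha_0$. For $x\in\widehat{\mathfrak h}_{\mathbb R}^*$ let $\overline x$ be the element of the span of $\alpha_1,\dots,\alpha_n,\omega_0$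 that is congruent to $x$ modulo $\mathbb R\delta$. The real roots are the $\widehat W$-conjugates of $\alpha_0,\dots,\alpha_n$; a real root is called long if its length is maximal among real roots (so if only one length occurs, all real roots are long). Let $s_0,\dots,s_n$ be coprime non-negative integers with $k\sum_i a_is_i=2$ (they describe an involution $\sigma$ of the simple Lie algebra of type $X_N$), and assume that there is an index $p$ such that $s_i=0$ if and only if $i\ne p$ (the semisimple case). Let $\Gamma_\sigma$ be the Dynkin graph of $\{\alpha_i: i\neq p\}$. For a connected component $\Sigma$ of $\Gamma_\sigma$ let $\Pi_\Sigma$ be its set of simple roots and $\theta_\Sigma$ the highest root of the finite root system with simple roots $\Pi_\Sigma$; let $\Pi_{\Sigma,f}=\Pi_\Sigma$ if $\alpha_0\notin\Pi_\Sigma$ and $\Pi_{\Sigma,f}=(\Pi_\Sigma\setminus\{\alpha_0\})\cup\{-\theta\}$ if $\alpha_0\in\Pi_\Sigma$; and let $\widehat\Pi_{\Sigma,f}=\Pi_{\Sigma,f}\cup\{k\delta-\overline{\theta}_\Sigma\}$. Let $W_{\sigma,f}$ and $\widehat W_{\sigma,f}$ be the groups generated by the reflections $s_\alpha$ with $\alpha\in\bigcup_\Sigma\Pi_{\Sigma,f}$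 and with $\alpha\in\bigcup_\Sigma\widehat\Pi_{\Sigma,f}$, respectively. Proposition 5.3. $\widehat W_{\sigma,f}$ is a subgroup of $\widehat W$, $W_{\sigma,f}$ is a subgroup of finite index of $W_f$, and $$[\widehat W:\widehat W_{\sigma,f}]=r_p\,k^{\,n-L}\,[W_f:W_{\sigma,f}],$$ where $L$ is the number of long roots in $\Pi_f$, and $r_p=2a_0$ if $\alpha_p$ is long, $r_p=a_0$ otherwise. Moreover, if there are real roots of different lengths and the diagram is not $G_2^{(1)}$, then $r_p$ is the ratio between the squared length of $\alpha_p$ and that of a real root of minimal length. -/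

import Mathlib

/-- The affine Dynkin diagrams `X_N^(k)`. The parameter `n` is the rank of the finite diagram that
is left when the vertex `0` is removed. -/
inductive AffineType : Type
  /-- `A_1^(1)` -/
  | A1
  /-- `A_n^(1)`, `n ≥ 2` -/
  | A (n : ℕ) (hn : 2 ≤ n)
  /-- `B_n^(1)`, `n ≥ 3` -/
  | B (n : ℕ) (hn : 3 ≤ n)
  /-- `C_n^(1)`, `n ≥ 2` -/
  | C (n : ℕ) (hn : 2 ≤ n)
  /-- `D_n^(1)`, `n ≥ 4` -/
  | D (n : ℕ) (hn : 4 ≤ n)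
  /-- `E_6^(1)` -/
  | E6
  /-- `E_7^(1)` -/
  | E7
  /-- `E_8^(1)` -/
  | E8
  /-- `F_4^(1)` -/
  | F4
  /-- `G_2^(1)` -/
  | G2
  /-- `A_2^(2)` -/
  | twA2
  /-- `A_{2n}^(2)`, `n ≥ 2` -/
  | twAEven (n : ℕ) (hn : 2 ≤ n)
  /-- `A_{2n-1}^(2)`, `n ≥ 3` -/
  | twAOdd (n : ℕ) (hn : 3 ≤ n)
  /-- `D_{n+1}^(2)`, `n ≥ 2` -/
  | twD (n : ℕ) (hn : 2 ≤ n)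
  /-- `E_6^(2)` -/
  | twE6
  /-- `D_4^(3)` -/
  | twD4

namespace AffineType

/-- The rank `n`; the vertices of the affine diagram are `0, …, n`. -/
def rank : AffineType → ℕ
  | A1 => 1
  | A n _ => n
  | B n _ => n
  | C n _ => n
  | D n _ => n
  | E6 => 6
  | E7 => 7
  | E8 => 8
  | F4 => 4
  | G2 => 2
  | twA2 => 1
  | twAEven n _ => n
  | twAOdd n _ => n
  | twD n _ => n
  | twE6 => 4
  | twD4 => 2

/-- The number `k` of `X_N^(k)`. -/
def tier : AffineType → ℕ
  | A1 | A _ _ | B _ _ | C _ _ | D _ _ | E6 | E7 | E8 | F4 | G2 => 1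
  | twA2 | twAEven _ _ | twAOdd _ _ | twD _ _ | twE6 => 2
  | twD4 => 3

/-- `i` and `j` are consecutive. -/
abbrev Chain (i j : ℕ) : Prop := i + 1 = j ∨ j + 1 = i

/-- Adjacency in the graph `0 — 2`, `1 — 2 — 3 — 4 — ⋯`. -/
abbrev ForkChain (i j : ℕ) : Prop :=
  (1 ≤ i ∧ 1 ≤ j ∧ Chain i j) ∨ (i = 0 ∧ j = 2) ∨ (i = 2 ∧ j = 0)

/-- The affine generalized Cartan matrix, with entries `a_{ij} = ⟨α_i^∨, α_j⟩`, so that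
`a_{ij} < -1` means that `α_i` is shorter than `α_j` (or, for `A_1^(1)`, of the same length). The
vertices are numbered as in Kac's tables Aff 1, Aff 2, Aff 3. -/
def cartan : (X : AffineType) → Matrix (Fin (X.rank + 1)) (Fin (X.rank + 1)) ℤ
  | A1 => !![ 2, -2;
             -2,  2]
  | A n _ => Matrix.of fun (i j : Fin (n + 1)) =>
      if i = j then 2
      else if Chain i j ∨ (i.val = 0 ∧ j.val = n) ∨ (i.val = n ∧ j.val = 0) then -1
      else 0
  | B n _ => Matrix.of fun (i j : Fin (n + 1)) =>
      if i = j then 2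
      else if i.val = n ∧ j.val + 1 = n then -2
      else if ForkChain i j then -1
      else 0
  | C n _ => Matrix.of fun (i j : Fin (n + 1)) =>
      if i = j then 2
      else if (i.val = 1 ∧ j.val = 0) ∨ (i.val + 1 = n ∧ j.val = n) then -2
      else if Chain i j then -1
      else 0
  | D n _ => Matrix.of fun (i j : Fin (n + 1)) =>
      if i = j then 2
      else if i.val < n ∧ j.val < n ∧ ForkChain i j then -1
      else if (i.val + 2 = n ∧ j.val = n) ∨ (i.val = n ∧ j.val + 2 = n) then -1
      else 0
  | E6 => !![ 2,  0,  0,  0,  0,  0, -1;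
              0,  2, -1,  0,  0,  0,  0;
              0, -1,  2, -1,  0,  0,  0;
              0,  0, -1,  2, -1,  0, -1;
              0,  0,  0, -1,  2, -1,  0;
              0,  0,  0,  0, -1,  2,  0;
             -1,  0,  0, -1,  0,  0,  2]
  | E7 => !![ 2, -1,  0,  0,  0,  0,  0,  0;
             -1,  2, -1,  0,  0,  0,  0,  0;
              0, -1,  2, -1,  0,  0,  0,  0;
              0,  0, -1,  2, -1,  0,  0, -1;
              0,  0,  0, -1,  2, -1,  0,  0;
              0,  0,  0,  0, -1,  2, -1,  0;
              0,  0,  0,  0,  0, -1,  2,  0;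
              0,  0,  0, -1,  0,  0,  0,  2]
  | E8 => !![ 2, -1,  0,  0,  0,  0,  0,  0,  0;
             -1,  2, -1,  0,  0,  0,  0,  0,  0;
              0, -1,  2, -1,  0,  0,  0,  0,  0;
              0,  0, -1,  2, -1,  0,  0,  0,  0;
              0,  0,  0, -1,  2, -1,  0,  0,  0;
              0,  0,  0,  0, -1,  2, -1,  0, -1;
              0,  0,  0,  0,  0, -1,  2, -1,  0;
              0,  0,  0,  0,  0,  0, -1,  2,  0;
              0,  0,  0,  0,  0, -1,  0,  0,  2]
  | F4 => !![ 2, -1,  0,  0,  0;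
             -1,  2, -1,  0,  0;
              0, -1,  2, -1,  0;
              0,  0, -2,  2, -1;
              0,  0,  0, -1,  2]
  | G2 => !![ 2, -1,  0;
             -1,  2, -1;
              0, -3,  2]
  | twA2 => !![ 2, -4;
               -1,  2]
  | twAEven n _ => Matrix.of fun (i j : Fin (n + 1)) =>
      if i = j then 2
      else if (i.val = 0 ∧ j.val = 1) ∨ (i.val + 1 = n ∧ j.val = n) then -2
      else if Chain i j then -1
      else 0
  | twAOdd n _ => Matrix.of fun (i j : Fin (n + 1)) =>
      if i = j then 2
      else if i.val + 1 = n ∧ j.val = n then -2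
      else if ForkChain i j then -1
      else 0
  | twD n _ => Matrix.of fun (i j : Fin (n + 1)) =>
      if i = j then 2
      else if (i.val = 0 ∧ j.val = 1) ∨ (i.val = n ∧ j.val + 1 = n) then -2
      else if Chain i j then -1
      else 0
  | twE6 => !![ 2, -1,  0,  0,  0;
               -1,  2, -1,  0,  0;
                0, -1,  2, -2,  0;
                0,  0, -1,  2, -1;
                0,  0,  0, -1,  2]
  | twD4 => !![ 2, -1,  0;
               -1,  2, -3;
                0, -1,  2]

/-- The labels `a_0, …, a_n` of the diagram: the coprime positive integers with
`∑ j, a_{ij} a_j = 0` for all `i`. -/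
def mark : (X : AffineType) → Fin (X.rank + 1) → ℕ
  | A1 => fun _ => 1
  | A _ _ => fun _ => 1
  | B n _ => fun (i : Fin (n + 1)) => if i.val ≤ 1 then 1 else 2
  | C n _ => fun (i : Fin (n + 1)) => if i.val = 0 ∨ i.val = n then 1 else 2
  | D n _ => fun (i : Fin (n + 1)) => if i.val ≤ 1 ∨ n ≤ i.val + 1 then 1 else 2
  | E6 => ![1, 1, 2, 3, 2, 1, 2]
  | E7 => ![1, 2, 3, 4, 3, 2, 1, 2]
  | E8 => ![1, 2, 3, 4, 5, 6, 4, 2, 3]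
  | F4 => ![1, 2, 3, 4, 2]
  | G2 => ![1, 2, 3]
  | twA2 => ![2, 1]
  | twAEven n _ => fun (i : Fin (n + 1)) => if i.val = n then 1 else 2
  | twAOdd n _ => fun (i : Fin (n + 1)) => if i.val ≤ 1 ∨ i.val = n then 1 else 2
  | twD _ _ => fun _ => 1
  | twE6 => ![1, 2, 3, 2, 1]
  | twD4 => ![1, 2, 1]

/-- The dual labels `a_0^∨, …, a_n^∨`: the coprime positive integers with
`∑ i, a_i^∨ a_{ij} = 0` for all `j`. -/
def comark : (X : AffineType) → Fin (X.rank + 1) → ℕ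
  | A1 => fun _ => 1
  | A _ _ => fun _ => 1
  | B n _ => fun (i : Fin (n + 1)) => if i.val ≤ 1 ∨ i.val = n then 1 else 2
  | C _ _ => fun _ => 1
  | D n _ => fun (i : Fin (n + 1)) => if i.val ≤ 1 ∨ n ≤ i.val + 1 then 1 else 2
  | E6 => ![1, 1, 2, 3, 2, 1, 2]
  | E7 => ![1, 2, 3, 4, 3, 2, 1, 2]
  | E8 => ![1, 2, 3, 4, 5, 6, 4, 2, 3]
  | F4 => ![1, 2, 3, 2, 1]
  | G2 => ![1, 2, 1]
  | twA2 => ![1, 2]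
  | twAEven n _ => fun (i : Fin (n + 1)) => if i.val = 0 then 1 else 2
  | twAOdd n _ => fun (i : Fin (n + 1)) => if i.val ≤ 1 then 1 else 2
  | twD n _ => fun (i : Fin (n + 1)) => if i.val = 0 ∨ i.val = n then 1 else 2
  | twE6 => ![1, 2, 3, 4, 2]
  | twD4 => ![1, 2, 3]

noncomputable section

/-- The real vector space of dimension `n + 2` with basis `α_0, …, α_n, ω_0`: the pair `(c, t)`
stands for `∑ i, c i • α_i + t • ω_0`. -/
abbrev Space (X : AffineType) : Type := (Fin (X.rank + 1) → ℝ) × ℝ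

/-- The simple root `α_i`. -/
def simpleRoot (X : AffineType) (i : Fin (X.rank + 1)) : X.Space := (Pi.single i 1, 0)

/-- The normalized standard invariant form: `(α_i, α_j) = (a_i^∨ / a_i) a_{ij}`,
`(ω_0, α_0^∨) = 1`, `(ω_0, α_i^∨) = 0` for `i ≥ 1`, `(ω_0, ω_0) = 0`, where
`α^∨ = 2 α / (α, α)`. -/
def form (X : AffineType) : X.Space →ₗ[ℝ] X.Space →ₗ[ℝ] ℝ :=
  LinearMap.mk₂ ℝ
    (fun x y =>
      (∑ i, ∑ j, ((X.comark i : ℝ) / (X.mark i : ℝ) * (X.cartan i j : ℝ)) * (x.1 i * y.1 j)) +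
        (X.comark 0 : ℝ) / (X.mark 0 : ℝ) * (x.2 * y.1 0 + x.1 0 * y.2))
    (by
      intro x x2 y
      simp only [Prod.fst_add, Prod.snd_add, Pi.add_apply, add_mul, mul_add,
        Finset.sum_add_distrib]
      ring)
    (by
      intro c x y
      simp only [Prod.smul_fst, Prod.smul_snd, Pi.smul_apply, smul_eq_mul, mul_add,
        Finset.mul_sum]
      congr 1
      · refine Finset.sum_congr rfl fun i _ => Finset.sum_congr rfl fun j _ => ?_
        ring
      · ring)
    (by
      intro x y y2
      simp only [Prod.fst_add, Prod.snd_add, Pi.add_apply, mul_add, Finset.sum_add_distrib]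
      ring)
    (by
      intro c x y
      simp only [Prod.smul_fst, Prod.smul_snd, Pi.smul_apply, smul_eq_mul, mul_add,
        Finset.mul_sum]
      congr 1
      · refine Finset.sum_congr rfl fun i _ => Finset.sum_congr rfl fun j _ => ?_
        ring
      · ring)

theorem reflection_involutive (X : AffineType) (α : X.Space) :
    Function.Involutive
      (LinearMap.id - ((2 / X.form α α) • (X.form.flip α)).smulRight α : X.Space →ₗ[ℝ] X.Space) := by
  intro x
  simp only [LinearMap.sub_apply, LinearMap.id_apply, LinearMap.smulRight_apply,
    LinearMap.smul_apply, LinearMap.flip_apply, map_sub, map_smul, smul_eq_mul]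
  by_cases h : X.form α α = 0
  · simp [h]
  · rw [div_mul_cancel₀ _ h]
    module

/-- The orthogonal reflection `s_α : x ↦ x - (2 (x, α) / (α, α)) α` in the vector `α` (only used for
`(α, α) ≠ 0`). -/
def refl (X : AffineType) (α : X.Space) : X.Space ≃ₗ[ℝ] X.Space :=
  LinearEquiv.ofInvolutive
    (LinearMap.id - ((2 / X.form α α) • (X.form.flip α)).smulRight α) (X.reflection_involutive α)

/-- The group generated by the reflections in the vectors of `S`. -/
def reflGroup (X : AffineType) (S : Set X.Space) : Subgroup (X.Space ≃ₗ[ℝ] X.Space) :=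
  Subgroup.closure (X.refl '' S)

/-- The affine Weyl group, generated by the simple reflections `s_{α_0}, …, s_{α_n}`. -/
def affineWeyl (X : AffineType) : Subgroup (X.Space ≃ₗ[ℝ] X.Space) :=
  X.reflGroup (Set.range X.simpleRoot)

/-- The finite Weyl group `W_f`, generated by `s_{α_1}, …, s_{α_n}`. -/
def finiteWeyl (X : AffineType) : Subgroup (X.Space ≃ₗ[ℝ] X.Space) :=
  X.reflGroup (X.simpleRoot '' {i | i ≠ 0})

/-- The real roots: the conjugates of the simple roots under the affine Weyl group. -/
def realRoots (X : AffineType) : Set X.Space :=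
  {β | ∃ w ∈ X.affineWeyl, ∃ i, β = w (X.simpleRoot i)}

/-- A long root: a real root of maximal length. If all real roots have the same length, then all
of them are long. -/
def IsLong (X : AffineType) (α : X.Space) : Prop :=
  α ∈ X.realRoots ∧ ∀ β ∈ X.realRoots, X.form β β ≤ X.form α α

/-- A real root of minimal length. -/
def IsOfMinLength (X : AffineType) (α : X.Space) : Prop :=
  α ∈ X.realRoots ∧ ∀ β ∈ X.realRoots, X.form α α ≤ X.form β β

/-- The number of long roots among `α_1, …, α_n`. -/
def numLong (X : AffineType) : ℕ :=
  {i : Fin (X.rank + 1) | i ≠ 0 ∧ X.IsLong (X.simpleRoot i)}.ncard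

/-- The fundamental imaginary root `δ = ∑ i, a_i α_i`. -/
def delta (X : AffineType) : X.Space := ∑ i, (X.mark i : ℝ) • X.simpleRoot i

/-- `θ = δ - a_0 α_0`. -/
def theta (X : AffineType) : X.Space := X.delta - (X.mark 0 : ℝ) • X.simpleRoot 0

/-- The projection modulo `δ`, where the quotient is identified with the span of
`α_1, …, α_n, ω_0`: it kills `δ` and fixes `α_1, …, α_n, ω_0`. -/
def bar (X : AffineType) (x : X.Space) : X.Space :=
  x - (x.1 0 / (X.mark 0 : ℝ)) • X.delta

/-- The root system generated by the simple roots `α_i`, `i ∈ S`. -/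
def rootsOf (X : AffineType) (S : Set (Fin (X.rank + 1))) : Set X.Space :=
  {β | ∃ w ∈ X.reflGroup (X.simpleRoot '' S), ∃ i ∈ S, β = w (X.simpleRoot i)}

/-- `γ` is the highest root of the root system generated by the `α_i`, `i ∈ S`: every root of it
is obtained from `γ` by subtracting simple roots. -/
def IsHighestRoot (X : AffineType) (S : Set (Fin (X.rank + 1))) (γ : X.Space) : Prop :=
  γ ∈ X.rootsOf S ∧ ∀ β ∈ X.rootsOf S, γ - β ∈ AddSubmonoid.closure (X.simpleRoot '' S)

/-- The Dynkin graph of the simple roots `α_i` with `s_i = 0`. -/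
def dynkinGraph (X : AffineType) (s : Fin (X.rank + 1) → ℕ) : SimpleGraph {i // s i = 0} :=
  SimpleGraph.fromRel fun i j => X.cartan i j ≠ 0

/-- The sets of vertices of the connected components `Σ` of the Dynkin graph of the simple roots
`α_i` with `s_i = 0`. -/
def components (X : AffineType) (s : Fin (X.rank + 1) → ℕ) : Set (Set (Fin (X.rank + 1))) :=
  {S | ∃ c : (X.dynkinGraph s).ConnectedComponent, S = Subtype.val '' c.supp}

/-- `Π_{Σ,f}`: the simple roots of the component `Σ`, with `α_0` replaced by `-θ` if it occurs. -/
def piF (X : AffineType) (S : Set (Fin (X.rank + 1))) : Set X.Space :=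
  {α | (∃ i ∈ S, i ≠ 0 ∧ α = X.simpleRoot i) ∨ (0 ∈ S ∧ α = -X.theta)}

/-- `Π̂_{Σ,f} = Π_{Σ,f} ∪ {kδ - θ̄_Σ}`, where `θ_Σ` is the highest root of `Σ`. -/
def piHatF (X : AffineType) (S : Set (Fin (X.rank + 1))) : Set X.Space :=
  X.piF S ∪ {α | ∃ γ, X.IsHighestRoot S γ ∧ α = (X.tier : ℝ) • X.delta - X.bar γ}

/-- `W_{σ,f}`: the group generated by the `s_α`, `α ∈ Π_{Σ,f}`, for all components `Σ`. -/
def subWeyl (X : AffineType) (s : Fin (X.rank + 1) → ℕ) :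
    Subgroup (X.Space ≃ₗ[ℝ] X.Space) :=
  X.reflGroup (⋃ S ∈ X.components s, X.piF S)

/-- `Ŵ_{σ,f}`: the group generated by the `s_α`, `α ∈ Π̂_{Σ,f}`, for all components `Σ`. -/
def subAffineWeyl (X : AffineType) (s : Fin (X.rank + 1) → ℕ) :
    Subgroup (X.Space ≃ₗ[ℝ] X.Space) :=
  X.reflGroup (⋃ S ∈ X.components s, X.piHatF S)

/-- The factor `r_p = a_0 (χ_ℓ(α_p) + 1)`, where `χ_ℓ(α_p)` is `1` if `α_p` is long and `0`
otherwise. -/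
def lengthFactor (X : AffineType) (p : Fin (X.rank + 1)) : ℕ :=
  open Classical in X.mark 0 * ((if X.IsLong (X.simpleRoot p) then 1 else 0) + 1)

end

end AffineType

/-!
Let `k = X.tier` and `α^∨ = 2 α / (α, α)`. The proof identifies both affine groups as
semidirect products of a lattice of translations and a finite reflection group that fixes `ω_0`,
and then counts.

* The reflection in `β + c δ` is the reflection in `β` followed by the translation by `-c β^∨`
  (`refl_add_smul_delta`). Hence `Ŵ` is the semidirect product of `W_f` and the lattice `M` spanned
  by the `W_f`-orbit of `θ^∨ = θ / a_0` (`affineWeyl_eq_semi`), and `Ŵ_{σ,f}` is the semidirect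
  product of `W_{σ,f}` and the lattice `M'` spanned by the conjugates of the `k θ_Σ^∨`
  modulo `δ`, which is the lattice spanned by the `k α_i^∨`, `i ≠ p`, modulo `δ`
  (`subAffineWeyl_eq_semi`).
* The coroots conjugate to that of a root of maximal length span the coroot lattice (`coroot_mem`),
  and the roots conjugate to a root of minimal length span the root lattice (`root_mem`). The first
  applies to the highest roots `θ_Σ`; for `θ`, the first applies if `θ` is long, and the second if
  it is short. In all cases `M` has a basis `μ_i α_i^∨`, `i ≠ 0` (`exists_isTransScaling`).
* As `∑ a_i^∨ α_i^∨ = δ`, the coroot `α_0^∨` is, modulo `δ`, minus the sum of the `a_i^∨ α_i^∨`,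
  `i ≠ 0`, and so the index of `M'` in `M` is `a_p^∨ ∏ (k / μ_i)` (`det_index_matrix`). The formula
  follows by comparing lengths in the three cases of `length_cases`.

No classification of the finite root systems is needed. All roots of a proper subdiagram, and `θ`,
are among the *root-like* vectors `x = ∑ c_i α_i` of squared length `m` with `(α_i, α_i) c_i ∈ m ℤ`.
These conditions are invariant under reflections, and squared lengths in the lattice they define
are multiples of `m`; since the form is positive definite on proper subdiagrams, a root-like vector
cannot have both a positive and a negative part, so all its coefficients have the same sign
(`nonneg_or_nonpos`). This yields the highest roots (`exists_isHighestRoot`), and the fact that the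
reflection in `θ` belongs to `W_f` (`refl_theta_mem`). By positivity there are also only finitely
many root-like vectors, which makes `W_f` finite (`finite_finiteWeyl`).
-/

namespace AffineType

variable {X : AffineType}

noncomputable section

/-! ### The tables -/

/-- A sum with at most five nonzero terms, around the index `i`: the rows of the Cartan matrices of
the infinite families have this shape. -/
theorem sum_range_eq_of_band {n : ℕ} (f : ℕ → ℤ) {i : ℕ} (hi : i ≤ n)
    (hf : ∀ j ≤ n, j + 2 < i ∨ i + 2 < j → f j = 0) :
    ∑ j ∈ Finset.range (n + 1), f j = (if 2 ≤ i then f (i - 2) else 0) +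
      (if 1 ≤ i then f (i - 1) else 0) + f i + (if i + 1 ≤ n then f (i + 1) else 0) +
      (if i + 2 ≤ n then f (i + 2) else 0) := by
  have key : ∀ j ∈ Finset.range (n + 1), f j =
      (if i - 2 = j then (if 2 ≤ i then f (i - 2) else 0) else 0) +
      (if i - 1 = j then (if 1 ≤ i then f (i - 1) else 0) else 0) + (if i = j then f i else 0) +
      (if i + 1 = j then f (i + 1) else 0) + (if i + 2 = j then f (i + 2) else 0) := by
    intro j hj
    have hj : j ≤ n := by simpa [Nat.lt_succ_iff] using hj
    by_cases h : j + 2 < i ∨ i + 2 < j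
    · rw [hf j hj h]
      have h1 : i - 2 ≠ j ∧ i - 1 ≠ j ∧ i ≠ j ∧ i + 1 ≠ j ∧ i + 2 ≠ j := by omega
      simp [h1]
    · obtain h | h | h | h | h : i = j + 2 ∨ i = j + 1 ∨ i = j ∨ j = i + 1 ∨ j = i + 2 := by omega
      all_goals subst h
      · have : j + 2 + 1 ≠ j ∧ j + 2 + 2 ≠ j := by omega
        simp [this]
      · have : j + 1 - 2 = j → ¬ 2 ≤ j + 1 := by omega
        simp; omega
      · have h2 : i - 2 = i → ¬ 2 ≤ i := by omega
        have h1 : i - 1 = i → ¬ 1 ≤ i := by omega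
        simp; grind
      · have : i - 2 ≠ i + 1 ∧ i - 1 ≠ i + 1 := by omega
        simp [this]
      · have : i - 2 ≠ i + 2 ∧ i - 1 ≠ i + 2 := by omega
        simp [this]
  rw [Finset.sum_congr rfl key]
  simp only [Finset.sum_add_distrib, Finset.sum_ite_eq, Finset.mem_range]
  have h1 : i - 2 < n + 1 ∧ i - 1 < n + 1 ∧ i < n + 1 := by omega
  simp only [h1, if_true, Nat.lt_succ_iff]

/-- The properties of an affine Cartan matrix `A = (a_{ij})` with labels `a` and dual labels `b` on
which the argument depends. Connectedness (`conn`) is given by a rooted spanning tree: every vertex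
`i ≠ 0` is adjacent to its parent, which has smaller depth. The field `dvd` says that
`(α_i, α_i) a_i = 2 b_i` is a multiple of `(θ, θ) = 2 a_0`. -/
structure IsAffineTable {n : ℕ} (A : Matrix (Fin (n + 1)) (Fin (n + 1)) ℤ)
    (a b : Fin (n + 1) → ℕ) : Prop where
  mark_pos : ∀ i, 0 < a i
  comark_pos : ∀ i, 0 < b i
  comark_zero : b 0 = 1
  diag : ∀ i, A i i = 2
  nonpos : ∀ i j, i ≠ j → A i j ≤ 0
  symm : ∀ i j, (b i * a j : ℤ) * A i j = (b j * a i : ℤ) * A j i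
  row : ∀ i, ∑ j, A i j * a j = 0
  conn : ∃ (par : Fin (n + 1) → Fin (n + 1)) (d : Fin (n + 1) → ℕ),
    ∀ i, i ≠ 0 → A (par i) i ≠ 0 ∧ d (par i) < d i
  dvd : ∀ i, i ≠ 0 → a 0 ∣ b i

/-- For the infinite families: the entries are given by functions on `ℕ`, and they vanish outside a
band, so that the row relations have five terms. -/
theorem IsAffineTable.of_nat {n : ℕ} (A : Matrix (Fin (n + 1)) (Fin (n + 1)) ℤ)
    (F : ℕ → ℕ → ℤ) (a b : ℕ → ℕ)
    (mark_pos : ∀ i ≤ n, 0 < a i) (comark_pos : ∀ i ≤ n, 0 < b i) (comark_zero : b 0 = 1)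
    (diag : ∀ i ≤ n, F i i = 2)
    (nonpos : ∀ i ≤ n, ∀ j ≤ n, i ≠ j → F i j ≤ 0)
    (symm : ∀ i ≤ n, ∀ j ≤ n, (b i * a j : ℤ) * F i j = (b j * a i : ℤ) * F j i)
    (band : ∀ i ≤ n, ∀ j ≤ n, j + 2 < i ∨ i + 2 < j → F i j = 0)
    (row : ∀ i ≤ n, (if 2 ≤ i then F i (i - 2) * a (i - 2) else 0) +
      (if 1 ≤ i then F i (i - 1) * a (i - 1) else 0) + F i i * a i +
      (if i + 1 ≤ n then F i (i + 1) * a (i + 1) else 0) +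
      (if i + 2 ≤ n then F i (i + 2) * a (i + 2) else 0) = 0)
    (par d : ℕ → ℕ)
    (conn : ∀ i ≤ n, i ≠ 0 → par i ≤ n ∧ F (par i) i ≠ 0 ∧ d (par i) < d i)
    (dvd : ∀ i ≤ n, i ≠ 0 → a 0 ∣ b i) (hA : ∀ i j, A i j = F i j) :
    IsAffineTable A (fun i => a i) (fun i => b i) where
  mark_pos i := mark_pos i (by omega)
  comark_pos i := comark_pos i (by omega)
  comark_zero := comark_zero
  diag i := hA i i ▸ diag i (by omega)
  nonpos i j h := hA i j ▸ nonpos i (by omega) j (by omega) (by omega)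
  symm i j := by rw [hA, hA]; exact symm i (by omega) j (by omega)
  row i := by
    have hi : i.val ≤ n := by omega
    have h := Fin.sum_univ_eq_sum_range (fun j => F i j * a j) (n + 1)
    simp only [hA]
    rw [h, sum_range_eq_of_band _ hi fun j hj hij => by simp [band i hi j hj hij]]
    exact row i hi
  conn := by
    refine ⟨fun i => Fin.ofNat (n + 1) (par i), fun i => d i, fun i hi => ?_⟩
    obtain ⟨h1, h2, h3⟩ := conn i (by omega) fun h => hi (Fin.ext h)
    have : par i % (n + 1) = par i := Nat.mod_eq_of_lt (by omega)
    simp only [hA, Fin.ofNat, this]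
    exact ⟨h2, h3⟩
  dvd i hi := dvd i (by omega) fun h => hi (Fin.ext h)

/-- For the exceptional diagrams: everything is decidable. The condition `A i j ≤ 0` is written with
`Int.toNat`. -/
theorem IsAffineTable.of_decide {n : ℕ} (A : Matrix (Fin (n + 1)) (Fin (n + 1)) ℤ)
    (a b : Fin (n + 1) → ℕ) (par : Fin (n + 1) → Fin (n + 1)) (d : Fin (n + 1) → ℕ)
    (h : decide ((∀ i, 0 < a i) ∧ (∀ i, 0 < b i) ∧ b 0 = 1 ∧ (∀ i, A i i = 2) ∧
      (∀ i j, i = j ∨ (A i j).toNat = 0) ∧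
      (∀ i j, (b i * a j : ℤ) * A i j = (b j * a i : ℤ) * A j i) ∧
      (∀ i, ∑ j, A i j * a j = 0) ∧
      (∀ i, i = 0 ∨ A (par i) i ≠ 0 ∧ d (par i) < d i) ∧ ∀ i, i = 0 ∨ a 0 ∣ b i) = true) :
    IsAffineTable A a b := by
  obtain ⟨h1, h2, h3, h4, h5, h6, h7, h8, h9⟩ := of_decide_eq_true h
  exact ⟨h1, h2, h3, h4, fun i j h => Int.toNat_eq_zero.1 ((h5 i j).resolve_left h), h6, h7,
    ⟨par, d, fun i => (h8 i).resolve_left⟩, fun i => (h9 i).resolve_left⟩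

theorem isAffineTable_E6 : IsAffineTable (cartan E6) (mark E6) (comark E6) :=
  .of_decide (n := 6) _ _ _ ![0, 2, 3, 6, 3, 4, 0] ![0, 4, 3, 2, 3, 4, 1] (by decide)

theorem isAffineTable_E7 : IsAffineTable (cartan E7) (mark E7) (comark E7) :=
  .of_decide (n := 7) _ _ _ ![0, 0, 1, 2, 3, 4, 5, 3] ![0, 1, 2, 3, 4, 5, 6, 4] (by decide)

theorem isAffineTable_E8 : IsAffineTable (cartan E8) (mark E8) (comark E8) :=
  .of_decide (n := 8) _ _ _ ![0, 0, 1, 2, 3, 4, 5, 6, 5] ![0, 1, 2, 3, 4, 5, 6, 7, 6] (by decide)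

theorem isAffineTable_F4 : IsAffineTable (cartan F4) (mark F4) (comark F4) :=
  .of_decide (n := 4) _ _ _ ![0, 0, 1, 2, 3] ![0, 1, 2, 3, 4] (by decide)

theorem isAffineTable_G2 : IsAffineTable (cartan G2) (mark G2) (comark G2) :=
  .of_decide (n := 2) _ _ _ ![0, 0, 1] ![0, 1, 2] (by decide)

theorem isAffineTable_twA2 : IsAffineTable (cartan twA2) (mark twA2) (comark twA2) :=
  .of_decide (n := 1) _ _ _ ![0, 0] ![0, 1] (by decide)

theorem isAffineTable_twE6 : IsAffineTable (cartan twE6) (mark twE6) (comark twE6) :=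
  .of_decide (n := 4) _ _ _ ![0, 0, 1, 2, 3] ![0, 1, 2, 3, 4] (by decide)

theorem isAffineTable_B (n : ℕ) (hn : 3 ≤ n) :
    IsAffineTable (cartan (B n hn)) (mark (B n hn)) (comark (B n hn)) := by
  refine IsAffineTable.of_nat (n := n) _
    (fun i j => if i = j then 2 else
      if i = n ∧ j + 1 = n then -2 else if ForkChain i j then -1 else 0)
    (fun i => if i ≤ 1 then 1 else 2) (fun i => if i ≤ 1 ∨ i = n then 1 else 2)
    (by grind) (by grind) (by grind) (by grind) (by grind) (by grind (splits := 30)) (by grind)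
    (by grind (splits := 30))
    (fun i => if i = 1 then 2 else if i = 2 then 0 else i - 1)
    (fun i => if i = 1 then 2 else i - 1) (by grind) (by grind)
    (fun i j => if_congr Fin.ext_iff rfl rfl)

theorem isAffineTable_C (n : ℕ) (hn : 2 ≤ n) :
    IsAffineTable (cartan (C n hn)) (mark (C n hn)) (comark (C n hn)) := by
  refine IsAffineTable.of_nat (n := n) _
    (fun i j => if i = j then 2 else
      if (i = 1 ∧ j = 0) ∨ (i + 1 = n ∧ j = n) then -2 else if Chain i j then -1 else 0)
    (fun i => if i = 0 ∨ i = n then 1 else 2) (fun i => 1)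
    (by grind) (by grind) (by grind) (by grind) (by grind) (by grind (splits := 30)) (by grind)
    (by grind (splits := 30))
    (fun i => i - 1)
    (fun i => i) (by grind) (by grind)
    (fun i j => if_congr Fin.ext_iff rfl rfl)

theorem isAffineTable_D (n : ℕ) (hn : 4 ≤ n) :
    IsAffineTable (cartan (D n hn)) (mark (D n hn)) (comark (D n hn)) := by
  refine IsAffineTable.of_nat (n := n) _
    (fun i j => if i = j then 2 else
      if i < n ∧ j < n ∧ ForkChain i j then -1 else
      if (i + 2 = n ∧ j = n) ∨ (i = n ∧ j + 2 = n) then -1 else 0)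
    (fun i => if i ≤ 1 ∨ n ≤ i + 1 then 1 else 2) (fun i => if i ≤ 1 ∨ n ≤ i + 1 then 1 else 2)
    (by grind) (by grind) (by grind) (by grind) (by grind) (by grind (splits := 30)) (by grind)
    (by grind (splits := 30))
    (fun i => if i = 1 then 2 else if i = 2 then 0 else if i = n then n - 2 else i - 1)
    (fun i => if i = 1 then 2 else i - 1) (by grind) (by grind)
    (fun i j => if_congr Fin.ext_iff rfl rfl)

theorem isAffineTable_twAEven (n : ℕ) (hn : 2 ≤ n) :
    IsAffineTable (cartan (twAEven n hn)) (mark (twAEven n hn)) (comark (twAEven n hn)) := by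
  refine IsAffineTable.of_nat (n := n) _
    (fun i j => if i = j then 2 else
      if (i = 0 ∧ j = 1) ∨ (i + 1 = n ∧ j = n) then -2 else if Chain i j then -1 else 0)
    (fun i => if i = n then 1 else 2) (fun i => if i = 0 then 1 else 2)
    (by grind) (by grind) (by grind) (by grind) (by grind) (by grind (splits := 30)) (by grind)
    (by grind (splits := 30))
    (fun i => i - 1)
    (fun i => i) (by grind)
    (by intro i hi h0; simp only [h0, if_false]; split_ifs <;> norm_num)
    (fun i j => if_congr Fin.ext_iff rfl rfl)

theorem isAffineTable_twAOdd (n : ℕ) (hn : 3 ≤ n) :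
    IsAffineTable (cartan (twAOdd n hn)) (mark (twAOdd n hn)) (comark (twAOdd n hn)) := by
  refine IsAffineTable.of_nat (n := n) _
    (fun i j => if i = j then 2 else
      if i + 1 = n ∧ j = n then -2 else if ForkChain i j then -1 else 0)
    (fun i => if i ≤ 1 ∨ i = n then 1 else 2) (fun i => if i ≤ 1 then 1 else 2)
    (by grind) (by grind) (by grind) (by grind) (by grind) (by grind (splits := 30)) (by grind)
    (by grind (splits := 30))
    (fun i => if i = 1 then 2 else if i = 2 then 0 else i - 1)
    (fun i => if i = 1 then 2 else i - 1) (by grind) (by grind)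
    (fun i j => if_congr Fin.ext_iff rfl rfl)

theorem isAffineTable_twD (n : ℕ) (hn : 2 ≤ n) :
    IsAffineTable (cartan (twD n hn)) (mark (twD n hn)) (comark (twD n hn)) := by
  refine IsAffineTable.of_nat (n := n) _
    (fun i j => if i = j then 2 else
      if (i = 0 ∧ j = 1) ∨ (i = n ∧ j + 1 = n) then -2 else if Chain i j then -1 else 0)
    (fun i => 1) (fun i => if i = 0 ∨ i = n then 1 else 2)
    (by grind) (by grind) (by grind) (by grind) (by grind) (by grind (splits := 30)) (by grind)
    (by grind (splits := 30))
    (fun i => i - 1)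
    (fun i => i) (by grind) (by grind)
    (fun i j => if_congr Fin.ext_iff rfl rfl)

/-- The remaining diagrams `A_n^(1)` and `D_4^(3)` have no vertex with `k a_p = 2`. -/
theorem isAffineTable_of_tier_mul_mark (X : AffineType) {p : Fin (X.rank + 1)}
    (h : X.tier * X.mark p = 2) : IsAffineTable X.cartan X.mark X.comark := by
  cases X with
  | A1 | A n hn => simp [tier, mark] at h
  | twD4 => simp only [tier] at h; omega
  | B n hn => exact isAffineTable_B n hn
  | C n hn => exact isAffineTable_C n hn
  | D n hn => exact isAffineTable_D n hn
  | E6 => exact isAffineTable_E6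
  | E7 => exact isAffineTable_E7
  | E8 => exact isAffineTable_E8
  | F4 => exact isAffineTable_F4
  | G2 => exact isAffineTable_G2
  | twA2 => exact isAffineTable_twA2
  | twAEven n hn => exact isAffineTable_twAEven n hn
  | twAOdd n hn => exact isAffineTable_twAOdd n hn
  | twD n hn => exact isAffineTable_twD n hn
  | twE6 => exact isAffineTable_twE6

/-- The only facts about the individual diagrams that are needed besides `IsAffineTable`. The
squared length of `α_i` is `2 a_i^∨ / a_i`, so they concern lengths; the third case consists
of the diagrams `A_{2n}^(2)`. -/
theorem length_cases (X : AffineType) {p : Fin (X.rank + 1)} (h : X.tier * X.mark p = 2) :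
    (X.tier = 1 ∧ X.mark 0 = 1 ∧ (∀ i, X.comark i ≤ X.mark i) ∧
      (X ≠ G2 → ∀ i, X.comark i = X.mark i ∨ 2 * X.comark i = X.mark i)) ∨
    (X.tier = 2 ∧ X.mark 0 = 1 ∧ (∀ i, X.comark i = X.mark i ∨ X.comark i = 2 * X.mark i) ∧
      ∃ i, i ≠ 0 ∧ X.comark i = 2 * X.mark i) ∨
    (X.tier = 2 ∧ X.mark 0 = 2 ∧ p ≠ 0 ∧ X.mark p = 1 ∧ (∀ i, i ≠ 0 → X.comark i = 2) ∧
      ∀ i, i ≠ 0 → i ≠ p → X.mark i = 2) := by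
  cases X with
  | A1 | A n hn => simp [tier, mark] at h
  | twD4 => simp only [tier] at h; omega
  | B n hn =>
    refine .inl ⟨rfl, by simp [mark], fun i => ?_, fun _ i => ?_⟩ <;> simp only [mark, comark] <;>
      grind
  | C n hn =>
    refine .inl ⟨rfl, by simp [mark], fun i => ?_, fun _ i => ?_⟩ <;> simp only [mark, comark] <;>
      grind
  | D n hn =>
    refine .inl ⟨rfl, by simp [mark], fun i => le_rfl, fun _ i => .inl rfl⟩
  | E6 => exact .inl ⟨rfl, rfl, fun i => le_rfl, fun _ i => .inl rfl⟩
  | E7 => exact .inl ⟨rfl, rfl, fun i => le_rfl, fun _ i => .inl rfl⟩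
  | E8 => exact .inl ⟨rfl, rfl, fun i => le_rfl, fun _ i => .inl rfl⟩
  | F4 => exact .inl ⟨rfl, rfl, by decide, fun _ => by decide⟩
  | G2 => exact .inl ⟨rfl, rfl, by decide, fun h => absurd rfl h⟩
  | twA2 =>
    refine .inr (.inr ?_)
    revert p
    decide
  | twAEven n hn =>
    refine .inr (.inr ⟨rfl, if_neg (by simp; omega), ?_⟩)
    change Fin (n + 1) at p
    simp only [tier, mark] at h
    have hp : p.val = n := by grind
    refine ⟨fun h0 => ?_, by simp [mark, hp], fun i hi => ?_, fun i hi hip => ?_⟩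
    · rw [h0] at hp
      simp at hp
      omega
    · change Fin (n + 1) at i
      have : i.val ≠ 0 := fun h => hi (Fin.ext h)
      simp [comark, this]
    · change Fin (n + 1) at i
      have : i.val ≠ n := fun h => hip (Fin.ext (h.trans hp.symm))
      simp [mark, this]
  | twAOdd n hn =>
    refine .inr (.inl ⟨rfl, by simp [mark], fun i => ?_, (⟨n, by omega⟩ : Fin (n + 1)), ?_, ?_⟩)
    · simp only [mark, comark]
      grind
    · exact fun h => by have := congrArg Fin.val h; simp at this; omega
    · simp only [mark, comark]
      grind
  | twD n hn =>
    refine .inr (.inl ⟨rfl, by simp [mark], fun i => ?_, (⟨1, by omega⟩ : Fin (n + 1)), ?_, ?_⟩)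
    · simp only [mark, comark]
      grind
    · exact fun h => by have := congrArg Fin.val h; simp at this
    · simp only [mark, comark]
      grind
  | twE6 => exact .inr (.inl ⟨rfl, rfl, by decide, (3 : Fin 5), (by decide : (3 : Fin 5) ≠ 0), rfl⟩)

/-- The Cartan matrix and the labels of `X` have the properties of `IsAffineTable`. -/
abbrev HasTable (X : AffineType) : Prop := IsAffineTable X.cartan X.mark X.comark

/-! ### The form on the root lattice -/

/-- The inner product `(α_i, α_j)`. -/
def gram (X : AffineType) (i j : Fin (X.rank + 1)) : ℝ :=
  (X.comark i : ℝ) / (X.mark i : ℝ) * (X.cartan i j : ℝ)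

theorem form_apply (x y : X.Space) :
    X.form x y = (∑ i, ∑ j, X.gram i j * (x.1 i * y.1 j)) +
      (X.comark 0 : ℝ) / (X.mark 0 : ℝ) * (x.2 * y.1 0 + x.1 0 * y.2) := rfl

theorem HasTable.mark_ne (hX : X.HasTable) (i) : (X.mark i : ℝ) ≠ 0 :=
  Nat.cast_ne_zero.2 (hX.mark_pos i).ne'

theorem HasTable.mark_pos' (hX : X.HasTable) (i) : (0 : ℝ) < X.mark i :=
  Nat.cast_pos.2 (hX.mark_pos i)

theorem HasTable.comark_pos' (hX : X.HasTable) (i) : (0 : ℝ) < X.comark i :=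
  Nat.cast_pos.2 (hX.comark_pos i)

theorem HasTable.gram_symm (hX : X.HasTable) (i j) : X.gram i j = X.gram j i := by
  have h := congrArg (Int.cast : ℤ → ℝ) (hX.symm i j)
  push_cast at h
  have hi := hX.mark_ne i
  have hj := hX.mark_ne j
  simp only [gram]
  field_simp
  linear_combination h

theorem HasTable.gram_nonpos (hX : X.HasTable) {i j} (h : i ≠ j) : X.gram i j ≤ 0 :=
  mul_nonpos_of_nonneg_of_nonpos (by positivity) (by exact_mod_cast hX.nonpos i j h)

theorem HasTable.gram_self (hX : X.HasTable) (i) :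
    X.gram i i = 2 * X.comark i / X.mark i := by
  simp only [gram, hX.diag i]
  push_cast
  ring

theorem HasTable.gram_self_pos (hX : X.HasTable) (i) : 0 < X.gram i i := by
  have h1 := hX.mark_pos' i
  have h2 := hX.comark_pos' i
  rw [hX.gram_self]
  positivity

theorem HasTable.gram_eq_zero (hX : X.HasTable) {i j} : X.gram i j = 0 ↔ X.cartan i j = 0 := by
  have h1 := hX.mark_ne i
  have h2 := (hX.comark_pos' i).ne'
  simp [gram, h1, h2]

/-- `a_{ij} (α_i, α_i) = 2 (α_i, α_j)`. -/
theorem HasTable.gram_self_mul_cartan (hX : X.HasTable) (i j) :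
    X.gram i i * X.cartan i j = 2 * X.gram i j := by
  rw [hX.gram_self, gram]
  ring

theorem HasTable.sum_gram_mark (hX : X.HasTable) (i) : ∑ j, X.gram i j * X.mark j = 0 := by
  have h := congrArg (Int.cast : ℤ → ℝ) (hX.row i)
  push_cast at h
  simp only [gram, mul_assoc, ← Finset.mul_sum, h, mul_zero]

theorem HasTable.form_comm (hX : X.HasTable) (x y : X.Space) : X.form x y = X.form y x := by
  rw [form_apply, form_apply, Finset.sum_comm]
  congr 1
  · refine Finset.sum_congr rfl fun i _ => Finset.sum_congr rfl fun j _ => ?_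
    rw [hX.gram_symm j i]
    ring
  · ring

theorem simpleRoot_snd (i) : (X.simpleRoot i).2 = 0 := rfl

theorem form_simpleRoot_right {x : X.Space} (hx : x.2 = 0) (j) :
    X.form x (X.simpleRoot j) = ∑ i, X.gram i j * x.1 i := by
  simp [form_apply, simpleRoot, hx, Pi.single_apply]

theorem form_simpleRoot (i j) : X.form (X.simpleRoot i) (X.simpleRoot j) = X.gram i j := by
  rw [form_simpleRoot_right rfl]
  simp [simpleRoot, Pi.single_apply]

theorem eq_sum_simpleRoot {x : X.Space} (hx : x.2 = 0) : x = ∑ i, x.1 i • X.simpleRoot i := by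
  ext i
  · simp [simpleRoot, Prod.fst_sum, Finset.sum_apply, Pi.single_apply]
  · simp [simpleRoot, Prod.snd_sum, hx]

theorem delta_fst (i) : X.delta.1 i = X.mark i := by
  simp [delta, simpleRoot, Prod.fst_sum, Finset.sum_apply, Pi.single_apply]

theorem delta_snd : X.delta.2 = 0 := by
  simp [delta, simpleRoot, Prod.snd_sum]

/-- The form pairs `δ` with the coefficient of `ω_0` only; this uses `a_0^∨ = 1`. -/
theorem HasTable.form_delta (hX : X.HasTable) (x : X.Space) : X.form x X.delta = x.2 := by
  rw [form_apply, delta_snd, delta_fst]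
  have h : ∀ i, ∑ j, X.gram i j * (x.1 i * X.delta.1 j) = 0 := fun i => by
    have := hX.sum_gram_mark i
    calc _ = x.1 i * ∑ j, X.gram i j * X.mark j := by
          rw [Finset.mul_sum]
          exact Finset.sum_congr rfl fun j _ => by rw [delta_fst]; ring
      _ = 0 := by rw [this, mul_zero]
  simp only [h, hX.comark_zero]
  have := hX.mark_ne 0
  field_simp
  simp

theorem HasTable.delta_form (hX : X.HasTable) (x : X.Space) : X.form X.delta x = x.2 := by
  rw [hX.form_comm, hX.form_delta]

/-! ### Positivity -/

/-- Since `δ` is in the kernel, the form is a sum of squares of differences over the edges of the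
diagram. -/
theorem HasTable.form_self_eq (hX : X.HasTable) {x : X.Space} (hx : x.2 = 0) :
    X.form x x = ∑ i, ∑ j, -(X.gram i j * X.mark i * X.mark j / 2) *
      (x.1 i / X.mark i - x.1 j / X.mark j) ^ 2 := by
  have h1 : ∑ i, ∑ j, X.gram i j * X.mark j * (x.1 i ^ 2 / X.mark i) = 0 :=
    Finset.sum_eq_zero fun i _ => by rw [← Finset.sum_mul, hX.sum_gram_mark, zero_mul]
  have h2 : ∑ i, ∑ j, X.gram i j * X.mark i * (x.1 j ^ 2 / X.mark j) = 0 := by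
    rw [Finset.sum_comm, ← h1]
    exact Finset.sum_congr rfl fun i _ => Finset.sum_congr rfl fun j _ => by
      rw [hX.gram_symm]
  have h3 : X.form x x = ∑ i, ∑ j, X.gram i j * (x.1 i * x.1 j) := by
    rw [form_apply, hx]
    ring
  have h4 : X.form x x = (∑ i, ∑ j, X.gram i j * (x.1 i * x.1 j)) -
      (∑ i, ∑ j, X.gram i j * X.mark j * (x.1 i ^ 2 / X.mark i)) / 2 -
      (∑ i, ∑ j, X.gram i j * X.mark i * (x.1 j ^ 2 / X.mark j)) / 2 := by
    rw [h1, h2, h3]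
    ring
  rw [h4]
  simp only [Finset.sum_div, ← Finset.sum_sub_distrib]
  refine Finset.sum_congr rfl fun i _ => Finset.sum_congr rfl fun j _ => ?_
  have hi := hX.mark_ne i
  have hj := hX.mark_ne j
  field_simp
  ring

theorem HasTable.term_nonneg (hX : X.HasTable) (x : X.Space) (i j) :
    0 ≤ -(X.gram i j * X.mark i * X.mark j / 2) * (x.1 i / X.mark i - x.1 j / X.mark j) ^ 2 := by
  by_cases h : i = j
  · simp [h]
  · have h1 := hX.gram_nonpos h
    have h2 := mul_nonneg (mul_nonneg (neg_nonneg.2 h1) (hX.mark_pos' i).le) (hX.mark_pos' j).le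
    exact mul_nonneg (by linarith) (sq_nonneg _)

theorem HasTable.term_le (hX : X.HasTable) {x : X.Space} (hx : x.2 = 0) (i j) :
    -(X.gram i j * X.mark i * X.mark j / 2) * (x.1 i / X.mark i - x.1 j / X.mark j) ^ 2 ≤
      X.form x x := by
  rw [hX.form_self_eq hx]
  refine le_trans ?_ (Finset.single_le_sum (f := fun i => ∑ j, _)
    (fun i _ => Finset.sum_nonneg fun j _ => hX.term_nonneg x i j) (Finset.mem_univ i))
  exact Finset.single_le_sum (fun j _ => hX.term_nonneg x i j) (Finset.mem_univ j)

/-- A nonempty set of vertices that is closed under adjacency contains every vertex. -/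
theorem HasTable.connected (hX : X.HasTable) {U : Set (Fin (X.rank + 1))} (hU : U.Nonempty)
    (h : ∀ i ∈ U, ∀ j, X.cartan i j ≠ 0 → j ∈ U) (i) : i ∈ U := by
  obtain ⟨par, d, hpar⟩ := hX.conn
  have hsymm : ∀ i j, X.cartan i j ≠ 0 → X.cartan j i ≠ 0 := fun i j hij => by
    rwa [ne_eq, ← hX.gram_eq_zero, hX.gram_symm, hX.gram_eq_zero]
  have up : ∀ m, ∀ i, d i ≤ m → 0 ∈ U → i ∈ U := fun m => by
    induction m with
    | zero =>
      intro i hi h0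
      by_cases hi0 : i = 0
      · exact hi0 ▸ h0
      · have := (hpar i hi0).2
        omega
    | succ m ih =>
      intro i hi h0
      by_cases hi0 : i = 0
      · exact hi0 ▸ h0
      · obtain ⟨h1, h2⟩ := hpar i hi0
        exact h _ (ih _ (by omega) h0) _ h1
  have down : ∀ m, ∀ i, d i ≤ m → i ∈ U → 0 ∈ U := fun m => by
    induction m with
    | zero =>
      intro i hi h0
      by_cases hi0 : i = 0
      · exact hi0 ▸ h0
      · have := (hpar i hi0).2
        omega
    | succ m ih =>
      intro i hi h0
      by_cases hi0 : i = 0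
      · exact hi0 ▸ h0
      · obtain ⟨h1, h2⟩ := hpar i hi0
        exact ih _ (by omega) (h _ h0 _ (hsymm _ _ h1))
  obtain ⟨u, hu⟩ := hU
  exact up _ i le_rfl (down _ u le_rfl hu)

/-- The form is positive definite on the vectors that miss a vertex `p`: a vector of length zero is
proportional to `δ`, by connectedness. -/
theorem HasTable.eq_zero_of_form_self (hX : X.HasTable) {x : X.Space} (hx : x.2 = 0) {p}
    (hp : x.1 p = 0) (h : X.form x x ≤ 0) : x = 0 := by
  have key : ∀ i, i ∈ {i | x.1 i = 0} := by
    refine hX.connected ⟨p, hp⟩ fun i (hi : x.1 i = 0) j hij => ?_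
    by_cases e : i = j
    · exact e ▸ hi
    have h1 := (hX.term_le hx i j).trans h
    have h2 : 0 < -(X.gram i j * X.mark i * X.mark j / 2) := by
      have := lt_of_le_of_ne (hX.gram_nonpos e) (mt hX.gram_eq_zero.1 hij)
      have := mul_pos (mul_pos (neg_pos.2 this) (hX.mark_pos' i)) (hX.mark_pos' j)
      linarith
    have h3 : (x.1 i / X.mark i - x.1 j / X.mark j) ^ 2 = 0 :=
      le_antisymm (nonpos_of_mul_nonpos_right h1 h2) (sq_nonneg _)
    rw [hi, zero_div, zero_sub, sq_eq_zero_iff, neg_eq_zero, div_eq_zero_iff] at h3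
    exact h3.resolve_right (hX.mark_ne j)
  ext i
  · exact key i
  · exact hx

/-! ### Reflections -/

theorem refl_apply (α x : X.Space) : X.refl α x = x - (2 / X.form α α * X.form x α) • α := rfl

theorem refl_refl (α x : X.Space) : X.refl α (X.refl α x) = x := X.reflection_involutive α x

theorem refl_inv (α : X.Space) : (X.refl α)⁻¹ = X.refl α := by
  ext1 x
  exact (LinearEquiv.symm_apply_eq _).2 (refl_refl α x).symm

theorem HasTable.form_refl (hX : X.HasTable) (α x y : X.Space) :
    X.form (X.refl α x) (X.refl α y) = X.form x y := by
  simp only [refl_apply, map_sub, map_smul, LinearMap.sub_apply, LinearMap.smul_apply,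
    smul_eq_mul]
  rw [hX.form_comm α y]
  by_cases h : X.form α α = 0
  · simp [h]
  · field_simp
    ring

theorem refl_smul {c : ℝ} (hc : c ≠ 0) (α : X.Space) : X.refl (c • α) = X.refl α := by
  ext1 x
  rw [refl_apply, refl_apply, smul_smul]
  simp only [map_smul, LinearMap.smul_apply, smul_eq_mul]
  congr 2
  by_cases h : X.form α α = 0
  · simp [h]
  · field_simp

theorem refl_neg (α : X.Space) : X.refl (-α) = X.refl α := by
  rw [← neg_one_smul ℝ α, refl_smul (by norm_num)]

theorem refl_conj (w : X.Space ≃ₗ[ℝ] X.Space) (hw : ∀ x y, X.form (w x) (w y) = X.form x y)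
    (α : X.Space) : w * X.refl α * w⁻¹ = X.refl (w α) := by
  ext1 x
  have h : X.form (w⁻¹ x) α = X.form x (w α) := by
    rw [← hw, show w (w⁻¹ x) = x from w.apply_symm_apply x]
  have h2 : w (w⁻¹ x) = x := w.apply_symm_apply x
  rw [LinearEquiv.mul_apply, LinearEquiv.mul_apply, refl_apply, refl_apply, map_sub, map_smul,
    hw, h, h2]

theorem refl_snd {α : X.Space} (hα : α.2 = 0) (x : X.Space) : (X.refl α x).2 = x.2 := by
  simp [refl_apply, hα]

theorem HasTable.refl_delta (hX : X.HasTable) {α : X.Space} (hα : α.2 = 0) :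
    X.refl α X.delta = X.delta := by
  rw [refl_apply, hX.delta_form, hα]
  simp

/-- Induction over a group generated by reflections, which are their own inverses. -/
theorem reflGroup_induction {S : Set X.Space} {P : (X.Space ≃ₗ[ℝ] X.Space) → Prop}
    (one : P 1) (mul : ∀ α ∈ S, ∀ w ∈ X.reflGroup S, P w → P (X.refl α * w))
    {w} (hw : w ∈ X.reflGroup S) : P w := by
  refine Subgroup.closure_induction_left (p := fun w _ => P w) one ?_ ?_ hw
  · rintro _ ⟨α, hα, rfl⟩ w hw h
    exact mul α hα w hw h
  · rintro _ ⟨α, hα, rfl⟩ w hw h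
    rw [refl_inv]
    exact mul α hα w hw h

theorem refl_mem_reflGroup {S : Set X.Space} {α : X.Space} (h : α ∈ S) :
    X.refl α ∈ X.reflGroup S := Subgroup.subset_closure ⟨α, h, rfl⟩

theorem reflGroup_le {S : Set X.Space} {G : Subgroup (X.Space ≃ₗ[ℝ] X.Space)}
    (h : ∀ α ∈ S, X.refl α ∈ G) : X.reflGroup S ≤ G := by
  rw [reflGroup, Subgroup.closure_le]
  rintro _ ⟨α, hα, rfl⟩
  exact h α hα

theorem HasTable.form_map (hX : X.HasTable) {S : Set X.Space} {w} (hw : w ∈ X.reflGroup S)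
    (x y : X.Space) : X.form (w x) (w y) = X.form x y := by
  revert x y
  refine reflGroup_induction (P := fun w => ∀ x y, X.form (w x) (w y) = X.form x y)
    (fun _ _ => rfl) (fun α _ w _ h x y => ?_) hw
  rw [LinearEquiv.mul_apply, LinearEquiv.mul_apply, hX.form_refl, h]

theorem refl_simpleRoot_mem {S : Set (Fin (X.rank + 1))} {i} (hi : i ∈ S) :
    X.refl (X.simpleRoot i) ∈ X.reflGroup (X.simpleRoot '' S) :=
  refl_mem_reflGroup ⟨i, hi, rfl⟩

/-- The reflections in all conjugates of the generators belong to the group. -/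
theorem HasTable.refl_map_mem (hX : X.HasTable) {S : Set X.Space} {w} (hw : w ∈ X.reflGroup S)
    {α : X.Space} (hα : X.refl α ∈ X.reflGroup S) : X.refl (w α) ∈ X.reflGroup S := by
  rw [← refl_conj w (hX.form_map hw)]
  exact mul_mem (mul_mem hw hα) (inv_mem hw)

theorem refl_simpleRoot_apply (i) (x : X.Space) :
    X.refl (X.simpleRoot i) x =
      x - (2 * X.form x (X.simpleRoot i) / X.gram i i) • X.simpleRoot i := by
  rw [refl_apply, form_simpleRoot]
  congr 2
  ring

/-! ### Integral vectors and nonnegative combinations of simple roots -/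

/-- The element `∑ c_i α_i` of the root lattice. -/
def vec (X : AffineType) (c : Fin (X.rank + 1) → ℤ) : X.Space := (fun i => (c i : ℝ), 0)

@[simp] theorem vec_fst (c : Fin (X.rank + 1) → ℤ) (i) : (X.vec c).1 i = c i := rfl

@[simp] theorem vec_snd (c : Fin (X.rank + 1) → ℤ) : (X.vec c).2 = 0 := rfl

theorem simpleRoot_eq_vec (i) : X.simpleRoot i = X.vec (Pi.single i 1) := by
  ext j
  · by_cases h : j = i
    · subst h
      simp [simpleRoot]
    · simp [simpleRoot, h]
  · rfl

/-- The nonnegative integral combinations of the simple roots `α_i`, `i ∈ S`. -/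
abbrev cone (X : AffineType) (S : Set (Fin (X.rank + 1))) : AddSubmonoid X.Space :=
  AddSubmonoid.closure (X.simpleRoot '' S)

theorem vec_mem_cone {S : Set (Fin (X.rank + 1))} {c : Fin (X.rank + 1) → ℤ}
    (hS : ∀ i ∉ S, c i = 0) (hc : ∀ i, 0 ≤ c i) : X.vec c ∈ X.cone S := by
  rw [eq_sum_simpleRoot (vec_snd c)]
  refine sum_mem fun i _ => ?_
  by_cases hi : i ∈ S
  · obtain ⟨n, hn⟩ := Int.eq_ofNat_of_zero_le (hc i)
    rw [vec_fst, hn, Int.cast_natCast, Nat.cast_smul_eq_nsmul]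
    exact nsmul_mem (AddSubmonoid.subset_closure (Set.mem_image_of_mem _ hi)) n
  · simp [hS i hi]

theorem nonneg_of_mem_cone {S : Set (Fin (X.rank + 1))} {x : X.Space} (hx : x ∈ X.cone S) :
    (∀ i, 0 ≤ x.1 i) ∧ x.2 = 0 := by
  induction hx using AddSubmonoid.closure_induction with
  | mem x h =>
    obtain ⟨j, -, rfl⟩ := h
    refine ⟨fun i => ?_, rfl⟩
    rw [simpleRoot_eq_vec, vec_fst, Pi.single_apply]
    split_ifs <;> simp
  | zero => simp
  | add x y _ _ hx hy => exact ⟨fun i => add_nonneg (hx.1 i) (hy.1 i), by simp [hx.2, hy.2]⟩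

theorem form_nonneg_of_mem_cone {S : Set (Fin (X.rank + 1))} {x y : X.Space} (hx : x ∈ X.cone S)
    (hy : ∀ i ∈ S, 0 ≤ X.form y (X.simpleRoot i)) : 0 ≤ X.form y x := by
  induction hx using AddSubmonoid.closure_induction with
  | mem x h =>
    obtain ⟨j, hj, rfl⟩ := h
    exact hy j hj
  | zero => simp
  | add x y _ _ hx hy => rw [map_add]; exact add_nonneg hx hy

/-! ### Root-like vectors -/

/-- The integral vectors of squared length `m` supported on `S` that satisfy
`(α_i, α_i) c_i ∈ m ℤ` for all `i`. -/
def rootLike (X : AffineType) (S : Set (Fin (X.rank + 1))) (m : ℝ) : Set X.Space :=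
  {x | ∃ c : Fin (X.rank + 1) → ℤ, (∀ i ∉ S, c i = 0) ∧
    (∀ i, X.gram i i * c i ∈ AddSubgroup.zmultiples m) ∧ X.form x x = m ∧ x = X.vec c}

theorem HasTable.two_mul_form_vec (hX : X.HasTable) (c : Fin (X.rank + 1) → ℤ) (k) :
    2 * X.form (X.vec c) (X.simpleRoot k) = X.gram k k * ((∑ i, X.cartan k i * c i : ℤ) : ℝ) := by
  push_cast
  rw [form_simpleRoot_right rfl, Finset.mul_sum, Finset.mul_sum]
  refine Finset.sum_congr rfl fun i _ => ?_
  rw [hX.gram_symm, vec_fst, ← mul_assoc, ← mul_assoc, hX.gram_self_mul_cartan]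

theorem HasTable.two_mul_form_mem (hX : X.HasTable) {m : ℝ} {c : Fin (X.rank + 1) → ℤ}
    (hc : ∀ i, X.gram i i * c i ∈ AddSubgroup.zmultiples m) (k) :
    2 * X.form (X.vec c) (X.simpleRoot k) ∈ AddSubgroup.zmultiples m := by
  rw [form_simpleRoot_right rfl, Finset.mul_sum]
  refine sum_mem fun i _ => ?_
  have := zsmul_mem (hc i) (X.cartan i k)
  convert this using 1
  rw [vec_fst, ← mul_assoc, ← hX.gram_self_mul_cartan, zsmul_eq_mul]
  ring

theorem HasTable.refl_vec (hX : X.HasTable) (c : Fin (X.rank + 1) → ℤ) (k) :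
    X.refl (X.simpleRoot k) (X.vec c) = X.vec (c - Pi.single k (∑ i, X.cartan k i * c i)) := by
  have h := (hX.gram_self_pos k).ne'
  rw [refl_simpleRoot_apply, hX.two_mul_form_vec, mul_div_cancel_left₀ _ h]
  ext j
  · by_cases hj : j = k
    · subst hj
      simp [simpleRoot]
    · simp [simpleRoot, hj]
  · simp [simpleRoot]

/-- The condition on the coefficients says that `2 x / m` is an integral combination of coroots,
which is why reflections preserve it. -/
theorem HasTable.refl_mem_rootLike (hX : X.HasTable) {S : Set (Fin (X.rank + 1))} {m : ℝ}
    {x : X.Space} (hx : x ∈ X.rootLike S m) {k} (hk : k ∈ S) :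
    X.refl (X.simpleRoot k) x ∈ X.rootLike S m := by
  obtain ⟨c, h1, h2, h3, rfl⟩ := hx
  refine ⟨_, fun i hi => ?_, fun i => ?_, (hX.form_refl _ _ _).trans h3, hX.refl_vec c k⟩
  · have : i ≠ k := fun e => hi (e ▸ hk)
    simp [this, h1 i hi]
  · by_cases hik : i = k
    · subst hik
      rw [Pi.sub_apply, Pi.single_eq_same, Int.cast_sub, mul_sub]
      refine sub_mem (h2 i) ?_
      rw [← hX.two_mul_form_vec]
      exact hX.two_mul_form_mem h2 i
    · simpa [hik] using h2 i

theorem HasTable.map_mem_rootLike (hX : X.HasTable) {S : Set (Fin (X.rank + 1))} {m : ℝ}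
    {w} (hw : w ∈ X.reflGroup (X.simpleRoot '' S)) {x : X.Space} (hx : x ∈ X.rootLike S m) :
    w x ∈ X.rootLike S m := by
  refine reflGroup_induction (P := fun w => w x ∈ X.rootLike S m) hx ?_ hw
  rintro _ ⟨k, hk, rfl⟩ w _ h
  exact hX.refl_mem_rootLike h hk

theorem simpleRoot_mem_rootLike {S : Set (Fin (X.rank + 1))} {i}
    (hi : i ∈ S) : X.simpleRoot i ∈ X.rootLike S (X.gram i i) := by
  refine ⟨Pi.single i 1, fun j hj => ?_, fun j => ?_, form_simpleRoot i i, simpleRoot_eq_vec i⟩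
  · have : j ≠ i := fun e => hj (e ▸ hi)
    simp [this]
  · by_cases h : j = i
    · subst h
      simp
    · simp [h]

/-- A symmetric quadratic form with values in `H` on the diagonal and polar form with values in `H`
has values in `H`. -/
theorem sum_sum_mem_of_symm {ι : Type*} [DecidableEq ι] (H : AddSubgroup ℝ) (f : ι → ι → ℝ)
    (hf : ∀ i j, f i j = f j i) (h1 : ∀ i, f i i ∈ H) (h2 : ∀ i j, 2 * f i j ∈ H)
    (s : Finset ι) : ∑ i ∈ s, ∑ j ∈ s, f i j ∈ H := by
  induction s using Finset.induction_on with
  | empty => simp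
  | insert a s ha ih =>
    have : ∑ i ∈ insert a s, ∑ j ∈ insert a s, f i j =
        f a a + ∑ j ∈ s, 2 * f a j + ∑ i ∈ s, ∑ j ∈ s, f i j := by
      simp only [Finset.sum_insert ha, Finset.sum_add_distrib, ← Finset.mul_sum]
      rw [Finset.sum_congr rfl fun i _ => hf i a]
      ring
    rw [this]
    exact add_mem (add_mem (h1 a) (sum_mem fun j _ => h2 a j)) ih

/-- The squared lengths of the vectors in the lattice `(α_i, α_i) c_i ∈ m ℤ` are multiples
of `m`. -/
theorem HasTable.form_vec_self_mem (hX : X.HasTable) {m : ℝ} {c : Fin (X.rank + 1) → ℤ}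
    (hc : ∀ i, X.gram i i * c i ∈ AddSubgroup.zmultiples m) :
    X.form (X.vec c) (X.vec c) ∈ AddSubgroup.zmultiples m := by
  have h : X.form (X.vec c) (X.vec c) = ∑ i, ∑ j, X.gram i j * (c i * c j) := by
    simp [form_apply]
  rw [h]
  refine sum_sum_mem_of_symm _ _ (fun i j => ?_) (fun i => ?_) (fun i j => ?_) _
  · rw [hX.gram_symm]
    ring
  · convert zsmul_mem (hc i) (c i) using 1
    rw [zsmul_eq_mul]
    ring
  · convert zsmul_mem (hc i) (X.cartan i j * c j) using 1
    rw [zsmul_eq_mul, Int.cast_mul]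
    linear_combination (-(c i : ℝ) * c j) * hX.gram_self_mul_cartan i j

/-- A nonzero vector of the lattice `(α_i, α_i) c_i ∈ m ℤ` that misses a vertex has squared length
at least `m`. -/
theorem HasTable.le_form_vec_self (hX : X.HasTable) {m : ℝ} (hm : 0 < m)
    {c : Fin (X.rank + 1) → ℤ} (hc : ∀ i, X.gram i i * c i ∈ AddSubgroup.zmultiples m) {p}
    (hp : c p = 0) (h0 : c ≠ 0) : m ≤ X.form (X.vec c) (X.vec c) := by
  obtain ⟨z, hz⟩ := AddSubgroup.mem_zmultiples_iff.1 (hX.form_vec_self_mem hc)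
  rw [zsmul_eq_mul] at hz
  by_contra! h
  rw [← hz] at h
  have hz1 : z < 1 := by
    by_contra! h1
    have : (1 : ℝ) ≤ z := by exact_mod_cast h1
    nlinarith
  have hz0 : (z : ℝ) ≤ 0 := by exact_mod_cast Int.lt_add_one_iff.1 hz1
  have h1 := hX.eq_zero_of_form_self (vec_snd c) (p := p) (by simp [hp])
    (by rw [← hz]; nlinarith)
  refine h0 (funext fun i => ?_)
  have h2 := congrArg (fun x : X.Space => x.1 i) h1
  simpa using h2

theorem HasTable.form_vec_nonpos (hX : X.HasTable) {c d : Fin (X.rank + 1) → ℤ}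
    (hc : ∀ i, 0 ≤ c i) (hd : ∀ i, 0 ≤ d i) (h : ∀ i, c i * d i = 0) :
    X.form (X.vec c) (X.vec d) ≤ 0 := by
  simp only [form_apply, vec_fst, vec_snd, zero_mul, mul_zero, add_zero]
  refine Finset.sum_nonpos fun i _ => Finset.sum_nonpos fun j _ => ?_
  by_cases hij : i = j
  · subst hij
    have : (c i : ℝ) * d i = 0 := by exact_mod_cast h i
    rw [this, mul_zero]
  · have h1 : (0 : ℝ) ≤ c i := by exact_mod_cast hc i
    have h2 : (0 : ℝ) ≤ d j := by exact_mod_cast hd j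
    exact mul_nonpos_of_nonpos_of_nonneg (hX.gram_nonpos hij) (mul_nonneg h1 h2)

/-- If both the positive part and the negative part of a root-like vector were nonzero, each of
them would have squared length at least `m`, and their inner product is not positive. -/
theorem HasTable.nonneg_or_nonpos (hX : X.HasTable) {S : Set (Fin (X.rank + 1))} {m : ℝ}
    (hm : 0 < m) {p} (hp : p ∉ S) {x : X.Space} (hx : x ∈ X.rootLike S m) :
    x ∈ X.cone S ∨ -x ∈ X.cone S := by
  obtain ⟨c, h1, h2, h3, rfl⟩ := hx
  have hsub : X.vec c = X.vec c⁺ - X.vec c⁻ := by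
    ext i
    · simp only [vec_fst, Prod.fst_sub, Pi.sub_apply]
      rw [← Int.cast_sub, ← Pi.sub_apply, posPart_sub_negPart]
    · simp
  have key : ∀ d : Fin (X.rank + 1) → ℤ, (∀ i, d i = c i ∨ d i = -c i ∨ d i = 0) → d ≠ 0 →
      m ≤ X.form (X.vec d) (X.vec d) := fun d hd hd0 => by
    refine hX.le_form_vec_self hm (fun i => ?_) (p := p) ?_ hd0
    · rcases hd i with h | h | h
      · rw [h]; exact h2 i
      · rw [h, Int.cast_neg, mul_neg]; exact neg_mem (h2 i)
      · simp [h]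
    · have := h1 p hp
      have := hd p
      omega
  have hpos : ∀ i, c⁺ i = max (c i) 0 := fun i => rfl
  have hneg : ∀ i, c⁻ i = max (-c i) 0 := fun i => rfl
  by_cases hc1 : c⁻ = 0
  · refine .inl (vec_mem_cone h1 fun i => ?_)
    have := congrFun hc1 i
    rw [hneg, Pi.zero_apply] at this
    omega
  by_cases hc2 : c⁺ = 0
  · refine .inr ?_
    have : -X.vec c = X.vec (-c) := by ext i <;> simp
    rw [this]
    refine vec_mem_cone (fun i hi => by simp [h1 i hi]) fun i => ?_
    have := congrFun hc2 i
    rw [hpos, Pi.zero_apply] at this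
    simp only [Pi.neg_apply]
    omega
  exfalso
  have k1 := key _ (fun i => by rw [hneg]; omega) hc1
  have k2 := key _ (fun i => by rw [hpos]; omega) hc2
  have k3 := hX.form_vec_nonpos (c := c⁺) (d := c⁻) (fun i => by rw [hpos]; omega)
    (fun i => by rw [hneg]; omega) (fun i => by
      rw [hpos, hneg]
      rcases le_total (c i) 0 with h | h
      · rw [max_eq_right h, zero_mul]
      · rw [max_eq_right (a := -c i) (by omega), mul_zero])
  rw [hsub] at h3
  simp only [map_sub, LinearMap.sub_apply] at h3
  rw [hX.form_comm (X.vec c⁻) (X.vec c⁺)] at h3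
  linarith

/-- The coordinates of the vectors of bounded length that miss the vertex `p` are bounded: this
spreads from `p` along the edges of the diagram. -/
theorem HasTable.exists_bound (hX : X.HasTable) (p) (m : ℝ) (i) :
    ∃ B : ℝ, ∀ x : X.Space, x.2 = 0 → x.1 p = 0 → X.form x x ≤ m → |x.1 i| ≤ B := by
  revert i
  refine hX.connected (U := {i | ∃ B : ℝ, ∀ x : X.Space, x.2 = 0 → x.1 p = 0 →
    X.form x x ≤ m → |x.1 i| ≤ B}) ⟨p, 0, fun x _ hp _ => by simp [hp]⟩ ?_
  rintro i ⟨B, hB⟩ j hij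
  by_cases e : i = j
  · exact e ▸ ⟨B, hB⟩
  have h2 : 0 < -(X.gram i j * X.mark i * X.mark j / 2) := by
    have := lt_of_le_of_ne (hX.gram_nonpos e) (mt hX.gram_eq_zero.1 hij)
    have := mul_pos (mul_pos (neg_pos.2 this) (hX.mark_pos' i)) (hX.mark_pos' j)
    linarith
  set q := -(X.gram i j * X.mark i * X.mark j / 2)
  refine ⟨X.mark j * (B / X.mark i + (1 + m / q)), fun x hx hp hm => ?_⟩
  have h3 : q * (x.1 i / X.mark i - x.1 j / X.mark j) ^ 2 ≤ m := (hX.term_le hx i j).trans hm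
  have h4 := hB x hx hp hm
  have hi := hX.mark_pos' i
  have hj := hX.mark_pos' j
  set u := x.1 i / X.mark i
  set v := x.1 j / X.mark j with hv
  have h5 : (u - v) ^ 2 ≤ m / q := by
    rw [le_div_iff₀ h2]
    linarith
  have h6 : |v - u| ≤ 1 + m / q := by
    rw [abs_le]
    constructor <;> nlinarith
  have h7 : |u| ≤ B / X.mark i := by
    rw [abs_div, abs_of_pos hi]
    gcongr
  have h8 : x.1 j = X.mark j * v := by
    rw [hv]
    field_simp
  rw [h8, abs_mul, abs_of_pos hj]
  have h9 : |v| ≤ |u| + |v - u| := by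
    have := abs_add_le u (v - u)
    rwa [add_sub_cancel] at this
  gcongr
  linarith

theorem HasTable.finite_rootLike (hX : X.HasTable) {S : Set (Fin (X.rank + 1))} {p} (hp : p ∉ S)
    (m : ℝ) : (X.rootLike S m).Finite := by
  choose B hB using hX.exists_bound p m
  refine ((Set.finite_Icc (fun i => -⌈B i⌉) (fun i => ⌈B i⌉)).image X.vec).subset ?_
  rintro _ ⟨c, h1, -, h3, rfl⟩
  have key : ∀ i, |c i| ≤ ⌈B i⌉ := fun i => by
    have h := (hB i (X.vec c) rfl (by simp [h1 p hp]) h3.le).trans (Int.le_ceil _)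
    rw [vec_fst] at h
    exact_mod_cast h
  exact ⟨c, ⟨fun i => (abs_le.1 (key i)).1, fun i => (abs_le.1 (key i)).2⟩, rfl⟩

/-! ### Dominant and minimal conjugates -/

/-- The sum of the coefficients of the simple roots. -/
def height (x : X.Space) : ℝ := ∑ i, x.1 i

theorem height_sub_smul (x : X.Space) (t : ℝ) (i) :
    height (x - t • X.simpleRoot i) = height x - t := by
  simp [height, simpleRoot, Finset.sum_sub_distrib, Pi.single_apply]

/-- Every root-like vector lies below a dominant conjugate: one of maximal height. -/
theorem HasTable.exists_dominant (hX : X.HasTable) {S : Set (Fin (X.rank + 1))} {p} (hp : p ∉ S)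
    {m : ℝ} {x : X.Space} (hx : x ∈ X.rootLike S m) :
    ∃ w ∈ X.reflGroup (X.simpleRoot '' S), (∀ i ∈ S, 0 ≤ X.form (w x) (X.simpleRoot i)) ∧
      w x - x ∈ X.cone S := by
  obtain ⟨y, ⟨⟨w, hw, rfl⟩, hyx⟩, hmax⟩ := Set.exists_max_image
    {y | (∃ w ∈ X.reflGroup (X.simpleRoot '' S), y = w x) ∧ y - x ∈ X.cone S} height
    ((hX.finite_rootLike hp m).subset (by
      rintro _ ⟨⟨w, hw, rfl⟩, -⟩
      exact hX.map_mem_rootLike hw hx))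
    ⟨x, ⟨1, one_mem _, rfl⟩, by simp⟩
  refine ⟨w, hw, fun i hi => ?_, hyx⟩
  by_contra! hneg
  obtain ⟨c, -, -, -, hc⟩ := hX.map_mem_rootLike hw hx
  have hn := hX.gram_self_pos i
  have h1 := hX.two_mul_form_vec c i
  rw [← hc] at h1
  set z := ∑ j, X.cartan i j * c j
  have hz : z < 0 := by
    have : (z : ℝ) < 0 := by
      by_contra! h
      nlinarith
    exact_mod_cast this
  have h2 : X.refl (X.simpleRoot i) (w x) = w x - (z : ℝ) • X.simpleRoot i := by
    rw [refl_simpleRoot_apply, h1, mul_div_cancel_left₀ _ hn.ne']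
  have h3 := hmax (X.refl (X.simpleRoot i) (w x))
    ⟨⟨X.refl (X.simpleRoot i) * w, mul_mem (refl_simpleRoot_mem hi) hw, rfl⟩, by
      obtain ⟨n, hn⟩ := Int.eq_ofNat_of_zero_le (a := -z) (by omega)
      have : X.refl (X.simpleRoot i) (w x) - x = (w x - x) + n • X.simpleRoot i := by
        rw [h2, ← Nat.cast_smul_eq_nsmul ℝ, ← Int.cast_natCast, ← hn]
        push_cast
        module
      rw [this]
      exact add_mem hyx (nsmul_mem (AddSubmonoid.subset_closure (Set.mem_image_of_mem _ hi)) n)⟩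
  rw [h2, height_sub_smul] at h3
  have : (z : ℝ) < 0 := by exact_mod_cast hz
  linarith

/-- A root-like vector is, up to a scalar, conjugate to a simple root: to the nonnegative conjugate
of minimal height. -/
theorem HasTable.exists_smul_simpleRoot (hX : X.HasTable) {S : Set (Fin (X.rank + 1))} {p}
    (hp : p ∉ S) {m : ℝ} (hm : 0 < m) {x : X.Space} (hx : x ∈ X.rootLike S m)
    (hpos : x ∈ X.cone S) :
    ∃ w ∈ X.reflGroup (X.simpleRoot '' S), ∃ i ∈ S, ∃ t : ℝ, t ≠ 0 ∧ w x = t • X.simpleRoot i := by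
  obtain ⟨y, ⟨⟨w, hw, rfl⟩, hy⟩, hmin⟩ := Set.exists_min_image
    {y | (∃ w ∈ X.reflGroup (X.simpleRoot '' S), y = w x) ∧ y ∈ X.cone S} height
    ((hX.finite_rootLike hp m).subset (by
      rintro _ ⟨⟨w, hw, rfl⟩, -⟩
      exact hX.map_mem_rootLike hw hx))
    ⟨x, ⟨1, one_mem _, rfl⟩, hpos⟩
  have hwx := hX.map_mem_rootLike hw hx
  obtain ⟨hy0, hy2⟩ := nonneg_of_mem_cone hy
  obtain ⟨i, hi⟩ : ∃ i, 0 < (w x).1 i * X.form (w x) (X.simpleRoot i) := by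
    by_contra! h
    have h1 : X.form (w x) (w x) = ∑ i, (w x).1 i * X.form (w x) (X.simpleRoot i) := by
      conv_lhs => rw [congrArg (X.form (w x)) (eq_sum_simpleRoot hy2), map_sum]
      simp
    obtain ⟨c, -, -, h2, -⟩ := hwx
    have := Finset.sum_nonpos fun i (_ : i ∈ Finset.univ) => h i
    linarith
  have hf : 0 < X.form (w x) (X.simpleRoot i) := pos_of_mul_pos_right hi (hy0 i)
  have hc : (w x).1 i ≠ 0 := fun h => by simp [h] at hi
  have hiS : i ∈ S := by
    by_contra h
    obtain ⟨c, h1, -, -, h2⟩ := hwx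
    exact hc (by rw [h2, vec_fst, h1 i h, Int.cast_zero])
  refine ⟨w, hw, i, hiS, _, hc, ?_⟩
  have hr := hX.refl_mem_rootLike hwx hiS
  have hn := hX.gram_self_pos i
  have h2 := refl_simpleRoot_apply i (w x)
  rcases hX.nonneg_or_nonpos hm hp hr with h | h
  · have h3 := hmin _ ⟨⟨X.refl (X.simpleRoot i) * w, mul_mem (refl_simpleRoot_mem hiS) hw, rfl⟩, h⟩
    rw [LinearEquiv.mul_apply, h2, height_sub_smul] at h3
    have : 0 < 2 * X.form (w x) (X.simpleRoot i) / X.gram i i := by positivity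
    linarith
  · ext j
    · by_cases hj : j = i
      · subst hj
        simp [simpleRoot]
      · have h3 := (nonneg_of_mem_cone h).1 j
        rw [h2] at h3
        simp [simpleRoot, hj] at h3
        simpa [simpleRoot, hj] using le_antisymm h3 (hy0 j)
    · simp [hy2, simpleRoot]

/-! ### Highest roots -/

/-- The Dynkin graph of the simple roots `α_i`, `i ∈ S`, is connected. -/
def IsConn (X : AffineType) (S : Set (Fin (X.rank + 1))) : Prop :=
  ∀ U ⊆ S, U.Nonempty → (∀ i ∈ U, ∀ j ∈ S, X.cartan i j ≠ 0 → j ∈ U) → U = S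

/-- Every vertex of `S` is connected within `S` to a simple root that is not orthogonal to `γ`. -/
def Reaches (X : AffineType) (S : Set (Fin (X.rank + 1))) (γ : X.Space) : Prop :=
  ∀ U ⊆ S, (∀ i ∈ S, X.form γ (X.simpleRoot i) ≠ 0 → i ∈ U) →
    (∀ i ∈ U, ∀ j ∈ S, X.cartan i j ≠ 0 → j ∈ U) → U = S

theorem form_eq_sum {x : X.Space} (hx : x.2 = 0) (y : X.Space) :
    X.form y x = ∑ i, x.1 i * X.form y (X.simpleRoot i) := by
  rw [congrArg (X.form y) (eq_sum_simpleRoot hx), map_sum]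
  simp

theorem snd_of_mem_rootLike {S : Set (Fin (X.rank + 1))} {m : ℝ} {x : X.Space}
    (hx : x ∈ X.rootLike S m) : x.2 = 0 := by
  obtain ⟨c, -, -, -, rfl⟩ := hx
  rfl

theorem fst_of_mem_rootLike {S : Set (Fin (X.rank + 1))} {m : ℝ} {x : X.Space}
    (hx : x ∈ X.rootLike S m) {i} (hi : i ∉ S) : x.1 i = 0 := by
  obtain ⟨c, h, -, -, rfl⟩ := hx
  simp [h i hi]

theorem form_self_of_mem_rootLike {S : Set (Fin (X.rank + 1))} {m : ℝ} {x : X.Space}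
    (hx : x ∈ X.rootLike S m) : X.form x x = m := by
  obtain ⟨c, -, -, h, rfl⟩ := hx
  exact h

/-- The pairing of the coroot of a root-like vector with the root lattice is integral. -/
theorem HasTable.two_mul_form_mem_zmultiples (hX : X.HasTable) {S T : Set (Fin (X.rank + 1))}
    {m n : ℝ} {x y : X.Space} (hx : x ∈ X.rootLike S m) (hy : y ∈ X.rootLike T n) :
    2 * X.form x y ∈ AddSubgroup.zmultiples m := by
  obtain ⟨c, -, h, -, rfl⟩ := hx
  obtain ⟨d, -, -, -, rfl⟩ := hy
  rw [form_eq_sum rfl, Finset.mul_sum]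
  refine sum_mem fun i _ => ?_
  convert zsmul_mem (hX.two_mul_form_mem h i) (d i) using 1
  rw [zsmul_eq_mul, vec_fst]
  ring

theorem HasTable.form_sub_self_pos (hX : X.HasTable) {x y : X.Space} {p} (hx : x.2 = 0)
    (hy : y.2 = 0) (hxp : x.1 p = 0) (hyp : y.1 p = 0) (h : x ≠ y) :
    0 < X.form x x + X.form y y - 2 * X.form x y := by
  by_contra! h0
  refine h (sub_eq_zero.1 (hX.eq_zero_of_form_self (x := x - y) (p := p) ?_ ?_ ?_))
  · simp [hx, hy]
  · simp [hxp, hyp]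
  · simp only [map_sub, LinearMap.sub_apply, hX.form_comm y x]
    linarith

theorem HasTable.mem_cone_of_dominant (hX : X.HasTable) {S : Set (Fin (X.rank + 1))} {p}
    (hp : p ∉ S) {m : ℝ} (hm : 0 < m) {x : X.Space} (hx : x ∈ X.rootLike S m)
    (hd : ∀ i ∈ S, 0 ≤ X.form x (X.simpleRoot i)) : x ∈ X.cone S := by
  refine (hX.nonneg_or_nonpos hm hp hx).resolve_right fun h => ?_
  have := form_nonneg_of_mem_cone h hd
  rw [map_neg, form_self_of_mem_rootLike hx] at this
  linarith

/-- All coefficients of a dominant vector are positive if the diagram is connected. -/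
theorem HasTable.fst_pos_of_dominant (hX : X.HasTable) {S : Set (Fin (X.rank + 1))} {p}
    (hp : p ∉ S) (hS : X.IsConn S) {m : ℝ} (hm : 0 < m) {x : X.Space} (hx : x ∈ X.rootLike S m)
    (hd : ∀ i ∈ S, 0 ≤ X.form x (X.simpleRoot i)) {i} (hi : i ∈ S) : 0 < x.1 i := by
  have h0 := (nonneg_of_mem_cone (hX.mem_cone_of_dominant hp hm hx hd)).1
  refine lt_of_le_of_ne (h0 i) fun hi0 => ?_
  have hx2 := snd_of_mem_rootLike hx
  have hU := hS {j ∈ S | x.1 j = 0} (Set.sep_subset _ _) ⟨i, hi, hi0.symm⟩ ?_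
  · have hx0 : x = 0 := by
      ext j
      · by_cases hj : j ∈ S
        · rw [← hU] at hj
          exact hj.2
        · exact fst_of_mem_rootLike hx hj
      · exact hx2
    have := form_self_of_mem_rootLike hx
    rw [hx0, map_zero] at this
    exact hm.ne this
  · rintro j ⟨hj, hj0⟩ k hk hjk
    refine ⟨hk, ?_⟩
    by_cases hkj : k = j
    · exact hkj ▸ hj0
    have h1 := hd j hj
    rw [form_simpleRoot_right hx2] at h1
    have h2 : ∀ i ∈ Finset.univ, X.gram i j * x.1 i ≤ 0 := fun i _ => by
      by_cases hij : i = j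
      · simp [hij, hj0]
      · exact mul_nonpos_of_nonpos_of_nonneg (hX.gram_nonpos hij) (h0 i)
    have h3 := (Finset.sum_eq_zero_iff_of_nonpos h2).1 (le_antisymm (Finset.sum_nonpos h2) h1) k
      (Finset.mem_univ k)
    refine (mul_eq_zero.1 h3).resolve_left ?_
    rwa [hX.gram_symm, hX.gram_eq_zero]

/-- For a connected diagram, dominant vectors are never orthogonal. -/
theorem HasTable.form_pos_of_dominant (hX : X.HasTable) {S : Set (Fin (X.rank + 1))} {p}
    (hp : p ∉ S) (hS : X.IsConn S) {m n : ℝ} (hm : 0 < m) (hn : 0 < n) {x y : X.Space}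
    (hx : x ∈ X.rootLike S m) (hy : y ∈ X.rootLike S n)
    (hdx : ∀ i ∈ S, 0 ≤ X.form x (X.simpleRoot i))
    (hdy : ∀ i ∈ S, 0 ≤ X.form y (X.simpleRoot i)) : 0 < X.form x y := by
  have hy1 := fun i => hX.fst_pos_of_dominant hp hS hn hy hdy (i := i)
  have key : ∀ i ∈ Finset.univ, 0 ≤ y.1 i * X.form x (X.simpleRoot i) := fun i _ => by
    by_cases hi : i ∈ S
    · exact mul_nonneg (hy1 i hi).le (hdx i hi)
    · rw [fst_of_mem_rootLike hy hi, zero_mul]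
  have hxy := form_eq_sum (snd_of_mem_rootLike hy) x
  refine lt_of_le_of_ne (hxy ▸ Finset.sum_nonneg key) fun h0 => ?_
  rw [hxy] at h0
  have h1 := (Finset.sum_eq_zero_iff_of_nonneg key).1 h0.symm
  have h2 := form_eq_sum (snd_of_mem_rootLike hx) x
  rw [form_self_of_mem_rootLike hx, Finset.sum_eq_zero] at h2
  · exact hm.ne' h2
  · intro i hi
    by_cases hiS : i ∈ S
    · have := (mul_eq_zero.1 (h1 i hi)).resolve_left (hy1 i hiS).ne'
      rw [this, mul_zero]
    · rw [fst_of_mem_rootLike hx hiS, zero_mul]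

/-- The highest root of a connected diagram is the dominant root of maximal length. -/
theorem HasTable.exists_isHighestRoot (hX : X.HasTable) {S : Set (Fin (X.rank + 1))} {p}
    (hp : p ∉ S) (hS : X.IsConn S) (hne : S.Nonempty) :
    ∃ γ m, X.IsHighestRoot S γ ∧ 0 < m ∧ γ ∈ X.rootLike S m ∧ ∀ i ∈ S, X.gram i i ≤ m := by
  obtain ⟨l, hl, hmax⟩ := Set.exists_max_image S (fun i => X.gram i i) S.toFinite hne
  have hm := hX.gram_self_pos l
  set m := X.gram l l
  have hl' : X.simpleRoot l ∈ X.rootLike S m := simpleRoot_mem_rootLike hl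
  obtain ⟨w, hw, hd, -⟩ := hX.exists_dominant hp hl'
  have hγ := hX.map_mem_rootLike hw hl'
  have hrefl : X.refl (w (X.simpleRoot l)) ∈ X.reflGroup (X.simpleRoot '' S) :=
    hX.refl_map_mem hw (refl_simpleRoot_mem hl)
  have hroot : w (X.simpleRoot l) ∈ X.rootsOf S := ⟨w, hw, l, hl, rfl⟩
  set γ := w (X.simpleRoot l)
  refine ⟨γ, m, ⟨hroot, ?_⟩, hm, hγ, hmax⟩
  rintro _ ⟨w', hw', j, hj, rfl⟩
  have hn := hX.gram_self_pos j
  have hβ := hX.map_mem_rootLike hw' (simpleRoot_mem_rootLike hj)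
  obtain ⟨v, hv, hdv, hle⟩ := hX.exists_dominant hp hβ
  have hβ' := hX.map_mem_rootLike hv hβ
  set β := w' (X.simpleRoot j)
  have : γ - β = (γ - v β) + (v β - β) := by abel
  rw [this]
  refine add_mem ?_ hle
  by_cases heq : γ = v β
  · rw [heq, sub_self]
    exact zero_mem _
  have hpos := hX.form_pos_of_dominant hp hS hm hn hγ hβ' hd hdv
  obtain ⟨z, hz⟩ := AddSubgroup.mem_zmultiples_iff.1 (hX.two_mul_form_mem_zmultiples hγ hβ')
  rw [zsmul_eq_mul] at hz
  have hz0 : 0 < z := by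
    have : (0 : ℝ) < z := pos_of_mul_pos_left (by linarith) hm.le
    exact_mod_cast this
  have hlt := hX.form_sub_self_pos (snd_of_mem_rootLike hγ) (snd_of_mem_rootLike hβ')
    (fst_of_mem_rootLike hγ hp) (fst_of_mem_rootLike hβ' hp) heq
  have hgγ := form_self_of_mem_rootLike hγ
  rw [hgγ, form_self_of_mem_rootLike hβ', ← hz] at hlt
  have hjm := hmax j hj
  have hz1 : z < 2 := by
    by_contra! h
    have : (2 : ℝ) ≤ z := by exact_mod_cast h
    nlinarith
  obtain rfl : z = 1 := by omega
  rw [Int.cast_one, one_mul] at hz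
  have hs : X.refl γ (v β) = v β - γ := by
    rw [refl_apply, hX.form_comm (v β) γ, hgγ]
    have : 2 / m * X.form γ (v β) = 1 := by
      field_simp
      linarith
    rw [this, one_smul]
  have hδ := hX.map_mem_rootLike hrefl hβ'
  rw [hs] at hδ
  rcases hX.nonneg_or_nonpos hn hp hδ with h | h
  · have := form_nonneg_of_mem_cone h hd
    rw [map_sub, hgγ] at this
    linarith
  · rwa [neg_sub] at h

/-! ### Lattices spanned by an orbit -/

theorem IsConn.reaches {S : Set (Fin (X.rank + 1))} (hS : X.IsConn S) {m : ℝ} (hm : 0 < m)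
    {γ : X.Space} (hγ : γ ∈ X.rootLike S m) : X.Reaches S γ := by
  intro U hU h1 h2
  refine hS U hU ?_ h2
  by_contra h
  have h3 : X.form γ γ = 0 := by
    rw [form_eq_sum (snd_of_mem_rootLike hγ)]
    refine Finset.sum_eq_zero fun i _ => ?_
    by_cases hi : i ∈ S
    · have : X.form γ (X.simpleRoot i) = 0 := by
        by_contra h0
        exact h ⟨i, h1 i hi h0⟩
      rw [this, mul_zero]
    · rw [fst_of_mem_rootLike hγ hi, zero_mul]
  rw [form_self_of_mem_rootLike hγ] at h3
  exact hm.ne' h3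

/-- Some conjugate of `γ` has positive inner product with `α_i`. Otherwise the whole orbit of `γ` is
orthogonal to `α_i`, and this property spreads from `γ` to all simple roots, `α_i` included. -/
theorem HasTable.exists_form_pos (hX : X.HasTable) {S : Set (Fin (X.rank + 1))} {γ : X.Space}
    (hS : X.Reaches S γ) {i} (hi : i ∈ S) :
    ∃ w ∈ X.reflGroup (X.simpleRoot '' S), 0 < X.form (w γ) (X.simpleRoot i) := by
  set W := X.reflGroup (X.simpleRoot '' S)
  by_contra! hneg
  have hzero : ∀ w ∈ W, X.form (w γ) (X.simpleRoot i) = 0 := fun w hw => by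
    refine le_antisymm (hneg w hw) ?_
    have h := hneg _ (mul_mem (refl_simpleRoot_mem hi) hw)
    have hn := (hX.gram_self_pos i).ne'
    rw [LinearEquiv.mul_apply, refl_simpleRoot_apply, map_sub, map_smul, LinearMap.sub_apply,
      LinearMap.smul_apply, form_simpleRoot, smul_eq_mul, div_mul_cancel₀ _ hn] at h
    linarith
  -- the vectors whose orbit is orthogonal to `α_i` contain, with a vector, all simple roots that
  -- are not orthogonal to it
  have step : ∀ x : X.Space, (∀ w ∈ W, X.form (w x) (X.simpleRoot i) = 0) → ∀ j ∈ S,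
      X.form x (X.simpleRoot j) ≠ 0 →
      ∀ w ∈ W, X.form (w (X.simpleRoot j)) (X.simpleRoot i) = 0 := fun x hx j hj hxj w hw => by
    have h := hx _ (mul_mem hw (refl_simpleRoot_mem hj))
    have hn := (hX.gram_self_pos j).ne'
    rw [LinearEquiv.mul_apply, refl_simpleRoot_apply, map_sub, map_smul, map_sub, map_smul,
      LinearMap.sub_apply, LinearMap.smul_apply, hx w hw, zero_sub, neg_eq_zero, smul_eq_mul] at h
    refine (mul_eq_zero.1 h).resolve_left ?_
    exact div_ne_zero (mul_ne_zero two_ne_zero hxj) hn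
  have hU := hS {j ∈ S | ∀ w ∈ W, X.form (w (X.simpleRoot j)) (X.simpleRoot i) = 0}
    (Set.sep_subset _ _) (fun j hj h => ⟨hj, step γ hzero j hj h⟩)
    (fun j hj k hk hjk => ⟨hk, step _ hj.2 k hk (by rwa [form_simpleRoot, ne_eq, hX.gram_eq_zero])⟩)
  have hi' := hi
  rw [← hU] at hi'
  have := hi'.2 1 (one_mem _)
  rw [LinearEquiv.coe_one, id, form_simpleRoot] at this
  exact (hX.gram_self_pos i).ne' this

theorem map_mem_of_refl_mem {S : Set (Fin (X.rank + 1))} {N : AddSubgroup X.Space}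
    (hN : ∀ j ∈ S, ∀ v ∈ N, X.refl (X.simpleRoot j) v ∈ N) {w}
    (hw : w ∈ X.reflGroup (X.simpleRoot '' S)) {v : X.Space} (hv : v ∈ N) : w v ∈ N := by
  refine reflGroup_induction (P := fun w => w v ∈ N) hv ?_ hw
  rintro _ ⟨k, hk, rfl⟩ w _ h
  exact hN k hk _ h

/-- The coroots of the orbit of a root of maximal length span the coroot lattice. -/
theorem HasTable.coroot_mem (hX : X.HasTable) {S : Set (Fin (X.rank + 1))} {p} (hp : p ∉ S)
    {m : ℝ} (hm : 0 < m) {γ : X.Space} (hγ : γ ∈ X.rootLike S m) (hS : X.Reaches S γ)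
    {N : AddSubgroup X.Space} (hN : ∀ j ∈ S, ∀ v ∈ N, X.refl (X.simpleRoot j) v ∈ N)
    (hγN : (2 / m) • γ ∈ N) {i} (hi : i ∈ S) (hlen : X.gram i i ≤ m) :
    (2 / X.gram i i) • X.simpleRoot i ∈ N := by
  obtain ⟨w, hw, hpos⟩ := hX.exists_form_pos hS hi
  have hβN : (2 / m) • w γ ∈ N := by
    rw [← map_smul]
    exact map_mem_of_refl_mem hN hw hγN
  have hβ := hX.map_mem_rootLike hw hγ
  have hαi := simpleRoot_mem_rootLike hi
  set β := w γ
  have hn := hX.gram_self_pos i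
  by_cases heq : β = X.simpleRoot i
  · have : X.gram i i = m := by
      rw [← form_simpleRoot, ← heq, form_self_of_mem_rootLike hβ]
    rwa [this, ← heq]
  obtain ⟨z, hz⟩ := AddSubgroup.mem_zmultiples_iff.1 (hX.two_mul_form_mem_zmultiples hβ hαi)
  rw [zsmul_eq_mul] at hz
  have hz0 : 0 < z := by
    have : (0 : ℝ) < z := pos_of_mul_pos_left (by linarith) hm.le
    exact_mod_cast this
  have hlt := hX.form_sub_self_pos (snd_of_mem_rootLike hβ) (simpleRoot_snd i)
    (fst_of_mem_rootLike hβ hp) (fst_of_mem_rootLike hαi hp) heq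
  rw [form_self_of_mem_rootLike hβ, form_simpleRoot, ← hz] at hlt
  have hz1 : z < 2 := by
    by_contra! h
    have : (2 : ℝ) ≤ z := by exact_mod_cast h
    nlinarith
  obtain rfl : z = 1 := by omega
  rw [Int.cast_one, one_mul] at hz
  have h1 := sub_mem hβN (hN i hi _ hβN)
  rw [refl_simpleRoot_apply, sub_sub_cancel, map_smul, LinearMap.smul_apply, smul_eq_mul] at h1
  convert h1 using 2
  field_simp
  linarith

/-- The orbit of a root of minimal length spans the root lattice. -/
theorem HasTable.root_mem (hX : X.HasTable) {S : Set (Fin (X.rank + 1))} {p} (hp : p ∉ S)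
    {m : ℝ} {γ : X.Space} (hγ : γ ∈ X.rootLike S m) (hS : X.Reaches S γ)
    {N : AddSubgroup X.Space} (hN : ∀ j ∈ S, ∀ v ∈ N, X.refl (X.simpleRoot j) v ∈ N)
    (hγN : γ ∈ N) {i} (hi : i ∈ S) (hlen : m ≤ X.gram i i) : X.simpleRoot i ∈ N := by
  obtain ⟨w, hw, hpos⟩ := hX.exists_form_pos hS hi
  have hβN : w γ ∈ N := map_mem_of_refl_mem hN hw hγN
  have hβ := hX.map_mem_rootLike hw hγ
  have hαi := simpleRoot_mem_rootLike hi
  set β := w γ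
  have hn := hX.gram_self_pos i
  by_cases heq : β = X.simpleRoot i
  · rwa [← heq]
  obtain ⟨z, hz⟩ := AddSubgroup.mem_zmultiples_iff.1 (hX.two_mul_form_mem_zmultiples hαi hβ)
  rw [zsmul_eq_mul, hX.form_comm] at hz
  have hz0 : 0 < z := by
    have : (0 : ℝ) < z := pos_of_mul_pos_left (by linarith) hn.le
    exact_mod_cast this
  have hlt := hX.form_sub_self_pos (snd_of_mem_rootLike hβ) (simpleRoot_snd i)
    (fst_of_mem_rootLike hβ hp) (fst_of_mem_rootLike hαi hp) heq
  rw [form_self_of_mem_rootLike hβ, form_simpleRoot, ← hz] at hlt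
  have hz1 : z < 2 := by
    by_contra! h
    have : (2 : ℝ) ≤ z := by exact_mod_cast h
    nlinarith
  obtain rfl : z = 1 := by omega
  rw [Int.cast_one, one_mul] at hz
  have h1 := sub_mem hβN (hN i hi _ hβN)
  rw [refl_simpleRoot_apply, sub_sub_cancel, ← hz] at h1
  simpa [hn.ne'] using h1

/-! ### Translations -/

/-- The translation `t_v`, given by
`t_v x = x + (x, δ) v - ((x, v) + ½ (v, v) (x, δ)) δ`, where `v` is given by its coefficients in
the simple roots, so that `(v, δ) = 0`. -/
def transMap (X : AffineType) (v : Fin (X.rank + 1) → ℝ) : X.Space →ₗ[ℝ] X.Space :=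
  LinearMap.id + (LinearMap.snd ℝ _ ℝ).smulRight ((v, 0) : X.Space) -
    (X.form.flip (v, 0) + (X.form (v, 0) (v, 0) / 2) • LinearMap.snd ℝ _ ℝ).smulRight X.delta

theorem transMap_apply (v : Fin (X.rank + 1) → ℝ) (x : X.Space) :
    X.transMap v x = x + x.2 • ((v, 0) : X.Space) -
      (X.form x (v, 0) + X.form (v, 0) (v, 0) / 2 * x.2) • X.delta := rfl

theorem transMap_zero : X.transMap 0 = LinearMap.id := by
  refine LinearMap.ext fun x => ?_
  have : ((0, 0) : X.Space) = 0 := rfl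
  simp [transMap_apply, this]

theorem HasTable.transMap_add (hX : X.HasTable) (v w : Fin (X.rank + 1) → ℝ) :
    X.transMap (v + w) = X.transMap v ∘ₗ X.transMap w := by
  refine LinearMap.ext fun x => ?_
  have h : ((v + w, 0) : X.Space) = (v, 0) + (w, 0) := by simp
  rw [LinearMap.comp_apply, transMap_apply, transMap_apply, transMap_apply, h]
  simp only [map_add, map_sub, map_smul, LinearMap.add_apply, LinearMap.sub_apply,
    LinearMap.smul_apply, hX.delta_form, Prod.snd_add, Prod.snd_sub, Prod.smul_snd, delta_snd,
    smul_eq_mul, mul_zero, add_zero, sub_zero, hX.form_comm (w, 0) (v, 0)]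
  module

/-- The translations as a homomorphism. -/
def trans (hX : X.HasTable) :
    Multiplicative (Fin (X.rank + 1) → ℝ) →* (X.Space ≃ₗ[ℝ] X.Space) where
  toFun v := LinearEquiv.ofLinearMap (X.transMap v.toAdd) (X.transMap (-v.toAdd))
    (by rw [← hX.transMap_add, add_neg_cancel, transMap_zero])
    (by rw [← hX.transMap_add, neg_add_cancel, transMap_zero])
  map_one' := by
    ext1 x
    exact LinearMap.congr_fun transMap_zero x
  map_mul' v w := by
    ext1 x
    exact LinearMap.congr_fun (hX.transMap_add v.toAdd w.toAdd) x

/-- The translation by the vector `v`, for `(v, δ) = 0`; the coefficient of `ω_0` in `v`, which is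
`(v, δ)`, is ignored. -/
def tr (hX : X.HasTable) (v : X.Space) : X.Space ≃ₗ[ℝ] X.Space :=
  trans hX (Multiplicative.ofAdd v.1)

theorem tr_apply (hX : X.HasTable) {v : X.Space} (hv : v.2 = 0) (x : X.Space) :
    tr hX v x = x + x.2 • v - (X.form x v + X.form v v / 2 * x.2) • X.delta := by
  have : (v.1, 0) = v := by rw [← hv]
  change X.transMap v.1 x = _
  rw [transMap_apply, this]

theorem tr_add (hX : X.HasTable) (v w : X.Space) : tr hX (v + w) = tr hX v * tr hX w := by
  rw [tr, Prod.fst_add, ofAdd_add, map_mul]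
  rfl

theorem tr_zero (hX : X.HasTable) : tr hX 0 = 1 := by
  rw [tr, Prod.fst_zero, ofAdd_zero, map_one]

theorem tr_neg (hX : X.HasTable) (v : X.Space) : tr hX (-v) = (tr hX v)⁻¹ := by
  rw [tr, Prod.fst_neg, ofAdd_neg, map_inv]
  rfl

/-- The isometries that fix `δ`. -/
def isoms (X : AffineType) : Subgroup (X.Space ≃ₗ[ℝ] X.Space) where
  carrier := {w | (∀ x y, X.form (w x) (w y) = X.form x y) ∧ w X.delta = X.delta}
  one_mem' := ⟨fun _ _ => rfl, rfl⟩
  mul_mem' := by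
    rintro a b ⟨ha, ha'⟩ ⟨hb, hb'⟩
    exact ⟨fun x y => (ha _ _).trans (hb _ _), (congrArg a hb').trans ha'⟩
  inv_mem' := by
    rintro a ⟨ha, ha'⟩
    have h : ∀ x, a (a⁻¹ x) = x := a.apply_symm_apply
    refine ⟨fun x y => by rw [← ha, h, h], a.injective ?_⟩
    rw [h, ha']

theorem HasTable.map_snd (hX : X.HasTable) {w} (hw : w ∈ X.isoms) (x : X.Space) :
    (w x).2 = x.2 := by
  rw [← hX.form_delta, ← hX.form_delta, ← hw.1 x X.delta, hw.2]

theorem conj_tr (hX : X.HasTable) {w} (hw : w ∈ X.isoms) {v : X.Space} (hv : v.2 = 0) :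
    w * tr hX v = tr hX (w v) * w := by
  ext1 x
  rw [LinearEquiv.mul_apply, LinearEquiv.mul_apply, tr_apply hX hv,
    tr_apply hX ((hX.map_snd hw v).trans hv), hw.1, hw.1, hX.map_snd hw, map_sub, map_add,
    map_smul, map_smul, hw.2]

theorem HasTable.refl_mem_isoms (hX : X.HasTable) {α : X.Space} (hα : α.2 = 0) :
    X.refl α ∈ X.isoms := ⟨hX.form_refl α, hX.refl_delta hα⟩

/-- The reflection in `β + c δ` is the composition of the reflection in `β` and a translation. -/
theorem refl_add_smul_delta (hX : X.HasTable) {β : X.Space} (hβ : β.2 = 0)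
    (h : X.form β β ≠ 0) (c : ℝ) :
    X.refl (β + c • X.delta) = tr hX (-(c * (2 / X.form β β)) • β) * X.refl β := by
  ext1 x
  rw [LinearEquiv.mul_apply, tr_apply hX (by simp [hβ]), refl_snd hβ, refl_apply, refl_apply]
  simp only [map_add, map_sub, map_smul, LinearMap.add_apply, LinearMap.sub_apply,
    LinearMap.smul_apply, hX.form_delta, hX.delta_form, hβ, delta_snd, smul_eq_mul, mul_zero,
    add_zero]
  match_scalars <;> field_simp <;> ring

/-! ### Semidirect products -/

/-- The vectors of the span of `α_1, …, α_n`. -/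
def finPart (X : AffineType) : AddSubgroup X.Space where
  carrier := {v | v.2 = 0 ∧ v.1 0 = 0}
  zero_mem' := ⟨rfl, rfl⟩
  add_mem' := by
    rintro a b ⟨h1, h2⟩ ⟨h3, h4⟩
    exact ⟨by simp [h1, h3], by simp [h2, h4]⟩
  neg_mem' := by
    rintro a ⟨h1, h2⟩
    exact ⟨by simp [h1], by simp [h2]⟩

/-- The isometries that fix `δ` and `ω_0`. -/
def finIsoms (X : AffineType) : Subgroup (X.Space ≃ₗ[ℝ] X.Space) where
  carrier := {w | w ∈ X.isoms ∧ w (0, 1) = (0, 1)}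
  one_mem' := ⟨one_mem _, rfl⟩
  mul_mem' := by
    rintro a b ⟨ha, ha'⟩ ⟨hb, hb'⟩
    exact ⟨mul_mem ha hb, (congrArg a hb').trans ha'⟩
  inv_mem' := by
    rintro a ⟨ha, ha'⟩
    exact ⟨inv_mem ha, a.symm_apply_eq.2 ha'.symm⟩

theorem form_omega {v : X.Space} (hv : v ∈ X.finPart) : X.form (0, 1) v = 0 := by
  simp [form_apply, hv.2]

theorem HasTable.refl_mem_finIsoms (hX : X.HasTable) {α : X.Space} (hα : α ∈ X.finPart) :
    X.refl α ∈ X.finIsoms := by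
  refine ⟨hX.refl_mem_isoms hα.1, ?_⟩
  rw [refl_apply, form_omega hα]
  simp

/-- A translation by a vector of `finPart` is determined by its effect on `ω_0`. -/
theorem tr_eq_tr_of_omega (hX : X.HasTable) {v v' : X.Space} (hv : v ∈ X.finPart)
    (hv' : v' ∈ X.finPart) (h : tr hX v (0, 1) = tr hX v' (0, 1)) : v = v' := by
  rw [tr_apply hX hv.1, tr_apply hX hv'.1, form_omega hv, form_omega hv'] at h
  have h0 := congrArg (fun x : X.Space => x.1 0) h
  simp only [one_smul, zero_add, mul_one, Prod.fst_sub, Prod.fst_add, Prod.smul_fst, Pi.sub_apply,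
    Pi.smul_apply, hv.2, hv'.2, delta_fst, smul_eq_mul, zero_sub, neg_inj] at h0
  have h1 := mul_right_cancel₀ (hX.mark_ne 0) h0
  rw [h1] at h
  simpa using h

/-- The product of the group of translations by the vectors of `N` and of a group `W` that
preserves `N`. -/
def semi (hX : X.HasTable) (N : AddSubgroup X.Space) (W : Subgroup (X.Space ≃ₗ[ℝ] X.Space))
    (hN : N ≤ X.finPart) (hW : W ≤ X.finIsoms) (hWN : ∀ w ∈ W, ∀ v ∈ N, w v ∈ N) :
    Subgroup (X.Space ≃ₗ[ℝ] X.Space) where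
  carrier := {g | ∃ v ∈ N, ∃ w ∈ W, g = tr hX v * w}
  one_mem' := ⟨0, zero_mem _, 1, one_mem _, by rw [tr_zero, one_mul]⟩
  mul_mem' := by
    rintro _ _ ⟨v, hv, w, hw, rfl⟩ ⟨v', hv', w', hw', rfl⟩
    refine ⟨v + w v', add_mem hv (hWN w hw v' hv'), w * w', mul_mem hw hw', ?_⟩
    rw [tr_add, mul_assoc, mul_assoc, ← mul_assoc w, conj_tr hX (hW hw).1 (hN hv').1, mul_assoc]
  inv_mem' := by
    rintro _ ⟨v, hv, w, hw, rfl⟩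
    refine ⟨w⁻¹ (-v), hWN _ (inv_mem hw) _ (neg_mem hv), w⁻¹, inv_mem hw, ?_⟩
    rw [← conj_tr hX (hW (inv_mem hw)).1 (hN (neg_mem hv)).1, tr_neg, mul_inv_rev]

/-- Elements of `finIsoms` fix `ω_0`, so the factors can be read off from the image of `ω_0`. -/
theorem semi_unique (hX : X.HasTable) {v v' : X.Space} {w w' : X.Space ≃ₗ[ℝ] X.Space}
    (hv : v ∈ X.finPart) (hv' : v' ∈ X.finPart) (hw : w ∈ X.finIsoms) (hw' : w' ∈ X.finIsoms)
    (h : tr hX v * w = tr hX v' * w') : v = v' ∧ w = w' := by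
  have h1 := congrArg (fun g : X.Space ≃ₗ[ℝ] X.Space => g (0, 1)) h
  simp only [LinearEquiv.mul_apply, hw.2, hw'.2] at h1
  have h2 := tr_eq_tr_of_omega hX hv hv' h1
  rw [h2] at h
  exact ⟨h2, mul_left_cancel h⟩

/-- If `L = H K`, then `K` has the same index in `L` as `H ∩ K` has in `H`. -/
theorem relIndex_eq_of_mul {G : Type*} [Group G] {K H L : Subgroup G} (hHL : H ≤ L)
    (h : ∀ g ∈ L, ∃ a ∈ H, ∃ b ∈ K, g = a * b) : K.relIndex L = K.relIndex H := by
  refine (Nat.card_congr (Equiv.ofBijective _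
    ⟨(Subgroup.quotientSubgroupOfEmbeddingOfLE K hHL).injective, ?_⟩)).symm
  intro q
  obtain ⟨⟨g, hg⟩, rfl⟩ := QuotientGroup.mk_surjective q
  obtain ⟨a, ha, b, hb, rfl⟩ := h g hg
  refine ⟨QuotientGroup.mk ⟨a, ha⟩, ?_⟩
  rw [Subgroup.quotientSubgroupOfEmbeddingOfLE_apply_mk, QuotientGroup.eq,
    Subgroup.mem_subgroupOf]
  simpa using hb

/-- The group of translations by the vectors of `N`. -/
def transGroup (hX : X.HasTable) (N : AddSubgroup X.Space) : Subgroup (X.Space ≃ₗ[ℝ] X.Space) where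
  carrier := {g | ∃ v ∈ N, g = tr hX v}
  one_mem' := ⟨0, zero_mem _, (tr_zero hX).symm⟩
  mul_mem' := by
    rintro _ _ ⟨v, hv, rfl⟩ ⟨v', hv', rfl⟩
    exact ⟨v + v', add_mem hv hv', (tr_add hX v v').symm⟩
  inv_mem' := by
    rintro _ ⟨v, hv, rfl⟩
    exact ⟨-v, neg_mem hv, (tr_neg hX v).symm⟩

/-- The index of semidirect products is multiplicative, through the intermediate group with the
large lattice and the small linear part. -/
theorem relIndex_semi (hX : X.HasTable) {N N' : AddSubgroup X.Space}
    {W W' : Subgroup (X.Space ≃ₗ[ℝ] X.Space)} (hN : N ≤ X.finPart) (hW : W ≤ X.finIsoms)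
    (hWN : ∀ w ∈ W, ∀ v ∈ N, w v ∈ N) (hNN : N' ≤ N) (hWW : W' ≤ W)
    (hWN' : ∀ w ∈ W', ∀ v ∈ N', w v ∈ N') :
    (semi hX N' W' (hNN.trans hN) (hWW.trans hW) hWN').relIndex (semi hX N W hN hW hWN) =
      (transGroup hX N').relIndex (transGroup hX N) * W'.relIndex W := by
  have hWN1 : ∀ w ∈ W', ∀ v ∈ N, w v ∈ N := fun w hw => hWN w (hWW hw)
  set G := semi hX N W hN hW hWN
  set G1 := semi hX N W' hN (hWW.trans hW) hWN1
  set G2 := semi hX N' W' (hNN.trans hN) (hWW.trans hW) hWN'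
  have h1 : G1.relIndex G = W'.relIndex W := by
    rw [relIndex_eq_of_mul (K := G1) (H := W) (L := G), ← Subgroup.inf_relIndex_right]
    · congr 1
      ext g
      constructor
      · rintro ⟨⟨v, hv, w, hw, rfl⟩, hg⟩
        obtain ⟨-, h⟩ := semi_unique hX (zero_mem _) (hN hv) (hW hg) (hW (hWW hw))
          (v := 0) (by rw [tr_zero, one_mul])
        rwa [h]
      · exact fun hg => ⟨⟨0, zero_mem _, g, hg, by rw [tr_zero, one_mul]⟩, hWW hg⟩
    · exact fun g hg => ⟨0, zero_mem _, g, hg, by rw [tr_zero, one_mul]⟩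
    · rintro _ ⟨v, hv, w, hw, rfl⟩
      have hw' := inv_mem hw
      refine ⟨w, hw, tr hX (w⁻¹ v), ⟨w⁻¹ v, hWN _ hw' _ hv, 1, one_mem _, by rw [mul_one]⟩, ?_⟩
      rw [conj_tr hX (hW hw).1 (hN (hWN _ hw' _ hv)).1, show w (w⁻¹ v) = v from
        w.apply_symm_apply v]
  have h2 : G2.relIndex G1 = (transGroup hX N').relIndex (transGroup hX N) := by
    rw [relIndex_eq_of_mul (K := G2) (H := transGroup hX N) (L := G1),
      ← Subgroup.inf_relIndex_right]
    · congr 1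
      ext g
      constructor
      · rintro ⟨⟨v, hv, w, hw, h⟩, ⟨v', hv', rfl⟩⟩
        obtain ⟨h1, -⟩ := semi_unique hX (hN hv') (hN (hNN hv)) (one_mem _) (hW (hWW hw))
          (w := 1) (by rw [mul_one, h])
        exact ⟨v, hv, by rw [h1]⟩
      · rintro ⟨v, hv, rfl⟩
        exact ⟨⟨v, hv, 1, one_mem _, by rw [mul_one]⟩, v, hNN hv, rfl⟩
    · rintro _ ⟨v, hv, rfl⟩
      exact ⟨v, hv, 1, one_mem _, by rw [mul_one]⟩
    · rintro _ ⟨v, hv, w, hw, rfl⟩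
      exact ⟨_, ⟨v, hv, rfl⟩, w, ⟨0, zero_mem _, w, hw, by rw [tr_zero, one_mul]⟩, rfl⟩
  have h3 : G2 ≤ G1 := by
    rintro _ ⟨v, hv, w, hw, rfl⟩
    exact ⟨v, hNN hv, w, hw, rfl⟩
  have h4 : G1 ≤ G := by
    rintro _ ⟨v, hv, w, hw, rfl⟩
    exact ⟨v, hv, w, hWW hw, rfl⟩
  rw [← Subgroup.relIndex_mul_relIndex _ _ _ h3 h4, h1, h2]

/-! ### Index of lattices -/

theorem index_range_eq_natAbs_det {ι : Type*} [Fintype ι] [DecidableEq ι] (A : Matrix ι ι ℤ)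
    (hA : A.det ≠ 0) :
    (LinearMap.range A.mulVecLin).toAddSubgroup.index = A.det.natAbs := by
  have hinj : Function.Injective A.mulVecLin := Matrix.mulVec_injective_of_det_ne_zero hA
  have h := Submodule.natAbs_det_equiv (LinearMap.range A.mulVecLin)
    (LinearEquiv.ofInjective A.mulVecLin hinj)
  refine h.symm.trans ?_
  rw [← LinearMap.det_toLin' A]
  rfl

theorem mem_closure_range_iff {ι : Type*} [Fintype ι] (u : ι → X.Space) (v : X.Space) :
    v ∈ AddSubgroup.closure (Set.range u) ↔ ∃ c : ι → ℤ, v = ∑ i, c i • u i := by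
  classical
  constructor
  · intro h
    induction h using AddSubgroup.closure_induction with
    | mem x h =>
      obtain ⟨i, rfl⟩ := h
      exact ⟨Pi.single i 1, by simp [Pi.single_apply, ite_smul]⟩
    | zero => exact ⟨0, by simp⟩
    | add x y _ _ hx hy =>
      obtain ⟨c, rfl⟩ := hx
      obtain ⟨d, rfl⟩ := hy
      exact ⟨c + d, by simp [add_smul, Finset.sum_add_distrib]⟩
    | neg x _ hx =>
      obtain ⟨c, rfl⟩ := hx
      exact ⟨-c, by simp⟩
  · rintro ⟨c, rfl⟩
    exact sum_mem fun i _ => zsmul_mem (AddSubgroup.subset_closure (Set.mem_range_self i)) _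

theorem relIndex_transGroup (hX : X.HasTable) {ι : Type*} [Fintype ι] [DecidableEq ι]
    (u : ι → X.Space) (hu : ∀ i, u i ∈ X.finPart) (hli : LinearIndependent ℝ u)
    (A : Matrix ι ι ℤ) (hA : A.det ≠ 0) :
    (transGroup hX (AddSubgroup.closure (Set.range fun j => ∑ i, A i j • u i))).relIndex
      (transGroup hX (AddSubgroup.closure (Set.range u))) = A.det.natAbs := by
  have hfin : ∀ c : ι → ℤ, ∑ i, c i • u i ∈ X.finPart := fun c =>
    sum_mem fun i _ => zsmul_mem (hu i) _
  let ψ : Multiplicative (ι → ℤ) →* (X.Space ≃ₗ[ℝ] X.Space) :=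
    { toFun := fun c => tr hX (∑ i, c.toAdd i • u i)
      map_one' := by simp [tr_zero]
      map_mul' := fun c d => by simp [add_smul, Finset.sum_add_distrib, tr_add] }
  have hψ : Function.Injective ψ := by
    intro c d h
    have h1 := tr_eq_tr_of_omega hX (hfin c.toAdd) (hfin d.toAdd)
      (congrArg (fun g : X.Space ≃ₗ[ℝ] X.Space => g (0, 1)) h)
    have h2 : ∑ i, ((c.toAdd i - d.toAdd i : ℤ) : ℝ) • u i = 0 := by
      simp only [Int.cast_smul_eq_zsmul, sub_smul, Finset.sum_sub_distrib, h1, sub_self]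
    have h3 := Fintype.linearIndependent_iff.1 hli _ h2
    refine Multiplicative.toAdd.injective (funext fun i => ?_)
    have := h3 i
    rw [Int.cast_eq_zero, sub_eq_zero] at this
    exact this
  have e1 : transGroup hX (AddSubgroup.closure (Set.range u)) = (⊤ : Subgroup _).map ψ := by
    ext g
    constructor
    · rintro ⟨v, hv, rfl⟩
      obtain ⟨c, rfl⟩ := (mem_closure_range_iff u v).1 hv
      exact ⟨Multiplicative.ofAdd c, trivial, rfl⟩
    · rintro ⟨c, -, rfl⟩
      exact ⟨_, (mem_closure_range_iff u _).2 ⟨c.toAdd, rfl⟩, rfl⟩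
  have e2 : transGroup hX (AddSubgroup.closure (Set.range fun j => ∑ i, A i j • u i)) =
      (AddSubgroup.toSubgroup (LinearMap.range A.mulVecLin).toAddSubgroup).map ψ := by
    have key : ∀ c : ι → ℤ, ∑ j, c j • ∑ i, A i j • u i = ∑ i, (A.mulVec c) i • u i := fun c => by
      simp only [Finset.smul_sum, Matrix.mulVec, dotProduct, Finset.sum_smul, smul_smul]
      rw [Finset.sum_comm]
      simp only [mul_comm]
    ext g
    constructor
    · rintro ⟨v, hv, rfl⟩
      obtain ⟨c, rfl⟩ := (mem_closure_range_iff _ v).1 hv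
      exact ⟨Multiplicative.ofAdd (A.mulVec c), ⟨c, rfl⟩, congrArg (tr hX) (key c).symm⟩
    · rintro ⟨_, ⟨c, rfl⟩, rfl⟩
      exact ⟨_, (mem_closure_range_iff _ _).2 ⟨c, rfl⟩, congrArg (tr hX) (key c).symm⟩
  rw [e1, e2, Subgroup.relIndex_map_map_of_injective _ _ hψ, Subgroup.relIndex_top_right,
    AddSubgroup.index_toSubgroup, index_range_eq_natAbs_det A hA]

/-! ### Coroots -/

/-- The coroot `α_i^∨ = 2 α_i / (α_i, α_i)`. -/
def coroot (X : AffineType) (i : Fin (X.rank + 1)) : X.Space := (2 / X.gram i i) • X.simpleRoot i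

theorem coroot_snd (i) : (X.coroot i).2 = 0 := by simp [coroot, simpleRoot]

theorem HasTable.two_div_gram_self (hX : X.HasTable) (i) :
    2 / X.gram i i = X.mark i / X.comark i := by
  have h1 := hX.mark_ne i
  have h2 := (hX.comark_pos' i).ne'
  rw [hX.gram_self]
  field_simp

/-- The dual labels are the coefficients of `δ` in the coroots. -/
theorem HasTable.sum_comark_coroot (hX : X.HasTable) :
    ∑ i, (X.comark i : ℤ) • X.coroot i = X.delta := by
  rw [delta]
  refine Finset.sum_congr rfl fun i _ => ?_
  have h2 := (hX.comark_pos' i).ne'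
  rw [coroot, hX.two_div_gram_self, ← Int.cast_smul_eq_zsmul ℝ, smul_smul]
  congr 1
  push_cast
  field_simp

theorem HasTable.form_coroot (hX : X.HasTable) (i j) :
    X.form (X.coroot i) (X.simpleRoot j) = X.cartan i j := by
  have h := (hX.gram_self_pos i).ne'
  rw [coroot, map_smul, LinearMap.smul_apply, form_simpleRoot, smul_eq_mul]
  field_simp
  rw [hX.gram_self_mul_cartan]

theorem HasTable.refl_coroot (hX : X.HasTable) (i j) :
    X.refl (X.simpleRoot j) (X.coroot i) = X.coroot i - X.cartan i j • X.coroot j := by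
  rw [refl_simpleRoot_apply, hX.form_coroot, coroot, coroot, ← Int.cast_smul_eq_zsmul ℝ,
    smul_smul]
  congr 2
  ring

/-! ### The root `θ` -/

theorem theta_eq_vec : X.theta = X.vec fun i => if i = 0 then 0 else (X.mark i : ℤ) := by
  ext i
  · by_cases h : i = 0
    · subst h
      simp [theta, delta_fst, simpleRoot]
    · simp [theta, delta_fst, simpleRoot, h]
  · simp [theta, delta_snd, simpleRoot]

theorem theta_mem_finPart : X.theta ∈ X.finPart := by
  rw [theta_eq_vec]
  exact ⟨rfl, by simp⟩

/-- The vector `θ` has squared length `2 a_0`. -/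
theorem HasTable.form_theta (hX : X.HasTable) : X.form X.theta X.theta = 2 * X.mark 0 := by
  have h := hX.mark_ne 0
  rw [theta]
  simp only [map_sub, LinearMap.sub_apply, hX.form_delta, hX.delta_form, delta_snd, map_smul,
    LinearMap.smul_apply, form_simpleRoot, simpleRoot_snd, hX.gram_self, smul_eq_mul,
    hX.comark_zero]
  field_simp
  simp

theorem HasTable.theta_mem_rootLike (hX : X.HasTable) :
    X.theta ∈ X.rootLike {i | i ≠ 0} (2 * X.mark 0) := by
  refine ⟨_, fun i hi => ?_, fun i => ?_, hX.form_theta, theta_eq_vec⟩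
  · simp only [Set.mem_ofPred_eq, not_not] at hi
    simp [hi]
  · by_cases hi : i = 0
    · simp [hi]
    · obtain ⟨q, hq⟩ := hX.dvd i hi
      refine AddSubgroup.mem_zmultiples_iff.2 ⟨q, ?_⟩
      have h := hX.mark_ne i
      rw [hX.gram_self, hq, if_neg hi, zsmul_eq_mul]
      push_cast
      field_simp

theorem theta_mem_cone : X.theta ∈ X.cone {i | i ≠ 0} := by
  rw [theta_eq_vec]
  refine vec_mem_cone (fun i hi => ?_) fun i => ?_
  · simp only [Set.mem_ofPred_eq, not_not] at hi
    simp [hi]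
  · split_ifs <;> positivity

/-- Up to a scalar, `θ` is conjugate to a simple root. -/
theorem HasTable.refl_theta_mem (hX : X.HasTable) : X.refl X.theta ∈ X.finiteWeyl := by
  have h := hX.mark_pos' 0
  obtain ⟨w, hw, i, hi, t, ht, h⟩ := hX.exists_smul_simpleRoot (p := 0) (by simp) (by linarith)
    hX.theta_mem_rootLike theta_mem_cone
  have h2 : X.theta = w⁻¹ (t • X.simpleRoot i) := w.eq_symm_apply.2 h
  rw [h2]
  refine hX.refl_map_mem (inv_mem hw) ?_
  rw [refl_smul ht]
  exact refl_simpleRoot_mem hi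

/-- `θ` is connected within `Π_f` to all simple roots, because `α_0` is. -/
theorem HasTable.reaches_theta (hX : X.HasTable) : X.Reaches {i | i ≠ 0} X.theta := by
  intro U hU h1 h2
  refine hU.antisymm fun i hi => ?_
  have key := hX.connected (U := insert 0 U) ⟨0, Set.mem_insert _ _⟩ ?_ i
  · exact key.resolve_left hi
  · rintro j (rfl | hj) k hjk
    · by_cases hk : k = 0
      · exact .inl hk
      refine .inr (h1 k hk ?_)
      rw [theta, map_sub, LinearMap.sub_apply, hX.delta_form, simpleRoot_snd, map_smul,
        LinearMap.smul_apply, form_simpleRoot, smul_eq_mul, zero_sub, neg_ne_zero]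
      exact mul_ne_zero (hX.mark_ne 0) (mt hX.gram_eq_zero.1 hjk)
    · by_cases hk : k = 0
      · exact .inl hk
      exact .inr (h2 j hj k hk hjk)

/-! ### The projection modulo `δ` -/

theorem bar_add (x y : X.Space) : X.bar (x + y) = X.bar x + X.bar y := by
  simp only [bar, Prod.fst_add, Pi.add_apply, add_div]
  module

theorem bar_smul (c : ℝ) (x : X.Space) : X.bar (c • x) = c • X.bar x := by
  simp only [bar, Prod.smul_fst, Pi.smul_apply, smul_eq_mul, mul_div_assoc]
  module

/-- The projection modulo `δ` as a linear map. -/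
def barMap (X : AffineType) : X.Space →ₗ[ℝ] X.Space where
  toFun := X.bar
  map_add' := bar_add
  map_smul' := bar_smul

theorem barMap_apply (x : X.Space) : X.barMap x = X.bar x := rfl

theorem bar_snd (x : X.Space) : (X.bar x).2 = x.2 := by simp [bar, delta_snd]

theorem HasTable.bar_mem_finPart (hX : X.HasTable) {x : X.Space} (hx : x.2 = 0) :
    X.bar x ∈ X.finPart := by
  have h := hX.mark_ne 0
  refine ⟨(bar_snd x).trans hx, ?_⟩
  simp [bar, delta_fst, h]

theorem bar_of_mem {x : X.Space} (hx : x ∈ X.finPart) : X.bar x = x := by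
  simp [bar, hx.2]

theorem HasTable.bar_delta (hX : X.HasTable) : X.bar X.delta = 0 := by
  have h := hX.mark_ne 0
  simp [bar, delta_fst, h]

theorem HasTable.form_bar (hX : X.HasTable) {x y : X.Space} (hx : x.2 = 0) (hy : y.2 = 0) :
    X.form (X.bar x) (X.bar y) = X.form x y := by
  simp only [bar, map_sub, LinearMap.sub_apply, map_smul, LinearMap.smul_apply, hX.form_delta,
    hX.delta_form, hx, hy, delta_snd]
  simp

theorem HasTable.bar_refl (hX : X.HasTable) {α x : X.Space} (hα : α.2 = 0) (hx : x.2 = 0) :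
    X.bar (X.refl α x) = X.refl (X.bar α) (X.bar x) := by
  rw [refl_apply, refl_apply, hX.form_bar hα hα, hX.form_bar hx hα, ← barMap_apply, map_sub,
    map_smul]
  rfl

theorem simpleRoot_mem_finPart {i : Fin (X.rank + 1)} (hi : i ≠ 0) :
    X.simpleRoot i ∈ X.finPart := ⟨rfl, by simp [simpleRoot, hi.symm]⟩

theorem coroot_mem_finPart {i : Fin (X.rank + 1)} (hi : i ≠ 0) :
    X.coroot i ∈ X.finPart := ⟨coroot_snd i, by simp [coroot, simpleRoot, hi.symm]⟩

theorem HasTable.bar_simpleRoot_zero (hX : X.HasTable) :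
    X.bar (X.simpleRoot 0) = (-(1 / X.mark 0 : ℝ)) • X.theta := by
  have h := hX.mark_ne 0
  rw [bar, theta]
  simp only [simpleRoot, Pi.single_eq_same]
  match_scalars <;> field_simp

theorem HasTable.refl_bar_simpleRoot_zero (hX : X.HasTable) :
    X.refl (X.bar (X.simpleRoot 0)) = X.refl X.theta := by
  have h := hX.mark_ne 0
  rw [hX.bar_simpleRoot_zero, refl_smul (neg_ne_zero.2 (one_div_ne_zero h))]

theorem HasTable.bar_coroot_zero (hX : X.HasTable) :
    X.bar (X.coroot 0) = -∑ i : {i : Fin (X.rank + 1) // i ≠ 0}, (X.comark i : ℤ) • X.coroot i := by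
  have h := congrArg X.barMap hX.sum_comark_coroot
  rw [map_sum, barMap_apply X.delta, hX.bar_delta, Fintype.sum_eq_add_sum_subtype_ne _ 0,
    hX.comark_zero] at h
  simp only [map_zsmul, Nat.cast_one, one_smul, barMap_apply] at h
  rw [eq_neg_of_add_eq_zero_left h]
  exact congrArg Neg.neg (Finset.sum_congr rfl fun i _ => by
    rw [bar_of_mem (coroot_mem_finPart i.2)])

/-! ### The affine Weyl group as a semidirect product -/

theorem finiteWeyl_le_affineWeyl : X.finiteWeyl ≤ X.affineWeyl :=
  reflGroup_le fun _ ⟨i, _, h⟩ => h ▸ refl_mem_reflGroup (Set.mem_range_self i)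

theorem HasTable.finiteWeyl_le_finIsoms (hX : X.HasTable) : X.finiteWeyl ≤ X.finIsoms := by
  refine reflGroup_le ?_
  rintro _ ⟨i, hi, rfl⟩
  exact hX.refl_mem_finIsoms (simpleRoot_mem_finPart hi)

/-- The reflection in `α_0 = (δ - θ) / a_0`. -/
theorem HasTable.refl_simpleRoot_zero (hX : X.HasTable) :
    X.refl (X.simpleRoot 0) = tr hX ((1 / X.mark 0 : ℝ) • X.theta) * X.refl X.theta := by
  have h := hX.mark_ne 0
  have h1 : X.refl (X.simpleRoot 0) = X.refl (-X.theta + (1 : ℝ) • X.delta) := by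
    rw [← refl_smul h (X.simpleRoot 0)]
    congr 1
    rw [theta]
    module
  have h2 : X.form (-X.theta) (-X.theta) = 2 * X.mark 0 := by
    simp [hX.form_theta]
  rw [h1, refl_add_smul_delta hX (by simp [theta_mem_finPart.1]) (by rw [h2]; simp [h]),
    refl_neg, h2]
  congr 2
  match_scalars
  field_simp

/-- The affine Weyl group is the semidirect product of `W_f` and any invariant lattice of
translations of it that contains `θ / a_0`. -/
theorem HasTable.affineWeyl_eq_semi (hX : X.HasTable) {N : AddSubgroup X.Space}
    (hN : N ≤ X.finPart) (hWN : ∀ w ∈ X.finiteWeyl, ∀ v ∈ N, w v ∈ N)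
    (hθ : (1 / X.mark 0 : ℝ) • X.theta ∈ N) (hNW : ∀ v ∈ N, tr hX v ∈ X.affineWeyl) :
    X.affineWeyl = semi hX N X.finiteWeyl hN hX.finiteWeyl_le_finIsoms hWN := by
  apply le_antisymm
  · refine reflGroup_le ?_
    rintro _ ⟨i, rfl⟩
    by_cases hi : i = 0
    · subst hi
      exact ⟨_, hθ, _, hX.refl_theta_mem, hX.refl_simpleRoot_zero⟩
    · exact ⟨0, zero_mem _, _, refl_simpleRoot_mem hi, by rw [tr_zero, one_mul]⟩
  · rintro _ ⟨v, hv, w, hw, rfl⟩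
    exact mul_mem (hNW v hv) (finiteWeyl_le_affineWeyl hw)

/-- The vectors whose translations belong to the group `G`. -/
def transLattice (hX : X.HasTable) (G : Subgroup (X.Space ≃ₗ[ℝ] X.Space)) :
    AddSubgroup X.Space where
  carrier := {v | v.2 = 0 ∧ tr hX v ∈ G}
  zero_mem' := ⟨rfl, by rw [tr_zero]; exact one_mem _⟩
  add_mem' := by
    rintro a b ⟨h1, h2⟩ ⟨h3, h4⟩
    exact ⟨by simp [h1, h3], by rw [tr_add]; exact mul_mem h2 h4⟩
  neg_mem' := by
    rintro a ⟨h1, h2⟩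
    exact ⟨by simp [h1], by rw [tr_neg]; exact inv_mem h2⟩

theorem HasTable.map_mem_transLattice (hX : X.HasTable) {G : Subgroup (X.Space ≃ₗ[ℝ] X.Space)} {w}
    (hw : w ∈ X.isoms) (hwG : w ∈ G) {v : X.Space} (hv : v ∈ transLattice hX G) :
    w v ∈ transLattice hX G := by
  refine ⟨(hX.map_snd hw v).trans hv.1, ?_⟩
  rw [← mul_inv_eq_of_eq_mul (conj_tr hX hw hv.1)]
  exact mul_mem (mul_mem hwG hv.2) (inv_mem hwG)

theorem HasTable.theta_mem_transLattice (hX : X.HasTable) :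
    (1 / X.mark 0 : ℝ) • X.theta ∈ transLattice hX X.affineWeyl := by
  refine ⟨by simp [theta_mem_finPart.1], ?_⟩
  rw [← mul_inv_eq_of_eq_mul hX.refl_simpleRoot_zero]
  exact mul_mem (refl_mem_reflGroup (Set.mem_range_self 0))
    (inv_mem (finiteWeyl_le_affineWeyl hX.refl_theta_mem))

theorem HasTable.refl_mem_transLattice (hX : X.HasTable) (j) (v : X.Space)
    (hv : v ∈ transLattice hX X.affineWeyl) :
    X.refl (X.simpleRoot j) v ∈ transLattice hX X.affineWeyl :=
  hX.map_mem_transLattice (hX.refl_mem_isoms rfl) (refl_mem_reflGroup (Set.mem_range_self j)) hv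

/-- If `θ` has maximal length, then the coroots are in the lattice of translations. -/
theorem HasTable.coroot_mem_transLattice (hX : X.HasTable) {i} (hi : i ≠ 0)
    (h : X.gram i i ≤ 2 * X.mark 0) : X.coroot i ∈ transLattice hX X.affineWeyl := by
  have hm := hX.mark_pos' 0
  refine hX.coroot_mem (S := {i | i ≠ 0}) (p := 0) (by simp) (by linarith) hX.theta_mem_rootLike
    hX.reaches_theta (fun j _ => hX.refl_mem_transLattice j) ?_ hi h
  have := hX.theta_mem_transLattice
  rwa [show (2 / (2 * X.mark 0) : ℝ) = 1 / X.mark 0 by field_simp]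

/-- If `θ` has minimal length, then the roots are in the lattice of translations. -/
theorem HasTable.simpleRoot_mem_transLattice (hX : X.HasTable) (h0 : X.mark 0 = 1) {i}
    (hi : i ≠ 0) (h : 2 ≤ X.gram i i) : X.simpleRoot i ∈ transLattice hX X.affineWeyl := by
  refine hX.root_mem (S := {i | i ≠ 0}) (p := 0) (by simp) hX.theta_mem_rootLike
    hX.reaches_theta (fun j _ => hX.refl_mem_transLattice j) ?_ hi (by simpa [h0] using h)
  have := hX.theta_mem_transLattice
  rwa [h0, Nat.cast_one, div_one, one_smul] at this

/-! ### The components of the Dynkin graph -/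

theorem exists_component {s : Fin (X.rank + 1) → ℕ} {i}
    (hi : s i = 0) : ∃ S ∈ X.components s, i ∈ S := by
  refine ⟨_, ⟨(X.dynkinGraph s).connectedComponentMk ⟨i, hi⟩, rfl⟩, ⟨i, hi⟩, ?_, rfl⟩
  exact SimpleGraph.ConnectedComponent.mem_supp_iff _ _ |>.2 rfl

theorem of_mem_component {s : Fin (X.rank + 1) → ℕ} {S} (hS : S ∈ X.components s) {i}
    (hi : i ∈ S) : s i = 0 := by
  obtain ⟨c, rfl⟩ := hS
  obtain ⟨j, -, rfl⟩ := hi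
  exact j.2

theorem HasTable.isConn_component (hX : X.HasTable) {s : Fin (X.rank + 1) → ℕ} {S}
    (hS : S ∈ X.components s) : X.IsConn S := by
  obtain ⟨c, rfl⟩ := hS
  rintro U hU ⟨u, hu⟩ h
  refine hU.antisymm ?_
  rintro _ ⟨v, hv, rfl⟩
  obtain ⟨u', hu', rfl⟩ := hU hu
  have hreach : (X.dynkinGraph s).Reachable u' v :=
    SimpleGraph.ConnectedComponent.exact (hu'.trans hv.symm)
  obtain ⟨q⟩ := hreach
  induction q with
  | nil => exact hu
  | @cons a b d hab q ih =>
    have hb : b ∈ c.supp := by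
      rw [SimpleGraph.ConnectedComponent.mem_supp_iff] at hu' ⊢
      rw [← hu']
      exact (SimpleGraph.ConnectedComponent.sound hab.reachable).symm
    refine ih hv hb (h _ hu _ ⟨b, hb, rfl⟩ ?_)
    rcases (SimpleGraph.fromRel_adj _ _ _).1 hab with ⟨-, h1 | h1⟩
    · exact h1
    · rwa [ne_eq, ← hX.gram_eq_zero, hX.gram_symm, hX.gram_eq_zero]

theorem HasTable.exists_highest_component (hX : X.HasTable) {s : Fin (X.rank + 1) → ℕ} {p}
    (hp : s p ≠ 0) {S} (hS : S ∈ X.components s) :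
    ∃ γ m, X.IsHighestRoot S γ ∧ 0 < m ∧ γ ∈ X.rootLike S m ∧ ∀ i ∈ S, X.gram i i ≤ m := by
  refine hX.exists_isHighestRoot (p := p) (fun h => hp (of_mem_component hS h))
    (hX.isConn_component hS) ?_
  obtain ⟨c, rfl⟩ := hS
  exact c.nonempty_supp.image _

/-! ### The subgroups of an involution -/

theorem HasTable.refl_bar_mem_subWeyl (hX : X.HasTable) {s : Fin (X.rank + 1) → ℕ} {i}
    (hi : s i = 0) : X.refl (X.bar (X.simpleRoot i)) ∈ X.subWeyl s := by
  obtain ⟨S, hS, hiS⟩ := exists_component hi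
  by_cases h0 : i = 0
  · subst h0
    rw [hX.refl_bar_simpleRoot_zero, ← refl_neg]
    exact refl_mem_reflGroup (Set.mem_biUnion hS (.inr ⟨hiS, rfl⟩))
  · rw [bar_of_mem (simpleRoot_mem_finPart h0)]
    exact refl_mem_reflGroup (Set.mem_biUnion hS (.inl ⟨i, hiS, h0, rfl⟩))

/-- `W_{σ,f}` is generated by the reflections in the projections of the `α_i` with `s_i = 0`,
because the projection of `α_0` is proportional to `θ`. -/
theorem HasTable.subWeyl_le (hX : X.HasTable) {s : Fin (X.rank + 1) → ℕ}
    {G : Subgroup (X.Space ≃ₗ[ℝ] X.Space)}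
    (h : ∀ i, s i = 0 → X.refl (X.bar (X.simpleRoot i)) ∈ G) : X.subWeyl s ≤ G := by
  refine reflGroup_le fun α hα => ?_
  obtain ⟨S, hS, hα⟩ := Set.mem_iUnion₂.1 hα
  rcases hα with ⟨i, hi, h0, rfl⟩ | ⟨h0, rfl⟩
  · have := h i (of_mem_component hS hi)
    rwa [bar_of_mem (simpleRoot_mem_finPart h0)] at this
  · have := h 0 (of_mem_component hS h0)
    rwa [hX.refl_bar_simpleRoot_zero, ← refl_neg] at this

theorem HasTable.subWeyl_le_finiteWeyl (hX : X.HasTable) (s : Fin (X.rank + 1) → ℕ) :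
    X.subWeyl s ≤ X.finiteWeyl := by
  refine hX.subWeyl_le fun i _ => ?_
  by_cases h0 : i = 0
  · subst h0
    rw [hX.refl_bar_simpleRoot_zero]
    exact hX.refl_theta_mem
  · rw [bar_of_mem (simpleRoot_mem_finPart h0)]
    exact refl_simpleRoot_mem h0

theorem subWeyl_le_subAffineWeyl (s : Fin (X.rank + 1) → ℕ) : X.subWeyl s ≤ X.subAffineWeyl s := by
  refine reflGroup_le fun α hα => ?_
  obtain ⟨S, hS, hα⟩ := Set.mem_iUnion₂.1 hα
  exact refl_mem_reflGroup (Set.mem_biUnion hS (.inl hα))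

/-- The action of the reflection group of a component modulo `δ` is that of an element
of `W_{σ,f}`. -/
theorem HasTable.exists_bar_map (hX : X.HasTable) {s : Fin (X.rank + 1) → ℕ}
    {S : Set (Fin (X.rank + 1))} (hS : ∀ i ∈ S, s i = 0) {w}
    (hw : w ∈ X.reflGroup (X.simpleRoot '' S)) :
    ∃ w' ∈ X.subWeyl s, ∀ x : X.Space, x.2 = 0 → X.bar (w x) = w' (X.bar x) ∧ (w x).2 = 0 := by
  refine reflGroup_induction (P := fun w => ∃ w' ∈ X.subWeyl s, ∀ x : X.Space, x.2 = 0 →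
    X.bar (w x) = w' (X.bar x) ∧ (w x).2 = 0) ⟨1, one_mem _, fun x hx => ⟨rfl, hx⟩⟩ ?_ hw
  rintro _ ⟨i, hi, rfl⟩ w - ⟨w', hw', h⟩
  refine ⟨X.refl (X.bar (X.simpleRoot i)) * w',
    mul_mem (hX.refl_bar_mem_subWeyl (hS i hi)) hw', fun x hx => ?_⟩
  obtain ⟨h1, h2⟩ := h x hx
  refine ⟨?_, (refl_snd rfl _).trans h2⟩
  rw [LinearEquiv.mul_apply, hX.bar_refl rfl h2, h1]
  rfl

/-- The lattice `k ⟨α_i^∨ : s_i = 0⟩` modulo `δ`. -/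
def subLattice (X : AffineType) (s : Fin (X.rank + 1) → ℕ) : AddSubgroup X.Space :=
  AddSubgroup.closure {v | ∃ i, s i = 0 ∧ v = X.bar ((X.tier : ℝ) • X.coroot i)}

theorem bar_coroot_mem_subLattice {s : Fin (X.rank + 1) → ℕ} {i} (hi : s i = 0) :
    X.bar ((X.tier : ℝ) • X.coroot i) ∈ X.subLattice s := AddSubgroup.subset_closure ⟨i, hi, rfl⟩

theorem HasTable.map_mem_subLattice (hX : X.HasTable) {s : Fin (X.rank + 1) → ℕ} {w}
    (hw : w ∈ X.subWeyl s) {v : X.Space} (hv : v ∈ X.subLattice s) : w v ∈ X.subLattice s := by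
  let stab : Subgroup (X.Space ≃ₗ[ℝ] X.Space) :=
    { carrier := {w | ∀ v, v ∈ X.subLattice s ↔ w v ∈ X.subLattice s}
      one_mem' := fun v => Iff.rfl
      mul_mem' := fun {a b} ha hb v => (hb v).trans (ha _)
      inv_mem' := fun {a} ha v => by
        rw [ha (a⁻¹ v), show a (a⁻¹ v) = v from a.apply_symm_apply v] }
  suffices h : X.subWeyl s ≤ stab from (h hw v).1 hv
  refine hX.subWeyl_le fun j hj => ?_
  have key : ∀ v ∈ X.subLattice s, X.refl (X.bar (X.simpleRoot j)) v ∈ X.subLattice s := by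
    intro v hv
    induction hv using AddSubgroup.closure_induction with
    | mem x h =>
      obtain ⟨i, hi, rfl⟩ := h
      rw [← hX.bar_refl rfl (by simp [coroot_snd]), map_smul, hX.refl_coroot, smul_sub,
        ← barMap_apply, map_sub, smul_comm, map_zsmul]
      exact sub_mem (bar_coroot_mem_subLattice hi)
        (zsmul_mem (bar_coroot_mem_subLattice hj) _)
    | zero => rw [map_zero]; exact zero_mem _
    | add x y _ _ hx hy => rw [map_add]; exact add_mem hx hy
    | neg x _ hx => rw [map_neg]; exact neg_mem hx
  exact fun v => ⟨key v, fun h => by simpa [refl_refl] using key _ h⟩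

theorem HasTable.subLattice_le_finPart (hX : X.HasTable) (s : Fin (X.rank + 1) → ℕ) :
    X.subLattice s ≤ X.finPart := by
  refine (AddSubgroup.closure_le _).2 ?_
  rintro _ ⟨i, -, rfl⟩
  exact hX.bar_mem_finPart (by simp [coroot_snd])

/-- The reflection in `k δ - γ̄` is the reflection in `γ̄` followed by the translation by `k γ^∨`
modulo `δ`. -/
theorem refl_tier_smul_delta_sub (hX : X.HasTable) {γ : X.Space} (hγ : γ.2 = 0)
    (h : X.form γ γ ≠ 0) (k : ℝ) :
    X.refl (k • X.delta - X.bar γ) =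
      tr hX (X.bar (k • (2 / X.form γ γ) • γ)) * X.refl (X.bar γ) := by
  have h1 : k • X.delta - X.bar γ = -X.bar γ + k • X.delta := by abel
  have h2 : X.form (-X.bar γ) (-X.bar γ) = X.form γ γ := by simp [hX.form_bar hγ hγ]
  rw [h1, refl_add_smul_delta hX (by simp [bar_snd, hγ]) (by rwa [h2]), refl_neg, h2,
    bar_smul, bar_smul]
  congr 2
  module

/-- The highest root of a component has maximal length in it, so the translations by the conjugates
of `k θ_Σ^∨` generate those by `k α_i^∨` for all `i` in the component. -/
theorem HasTable.subAffineWeyl_eq_semi (hX : X.HasTable) {s : Fin (X.rank + 1) → ℕ} {p}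
    (hp : s p ≠ 0) :
    X.subAffineWeyl s = semi hX (X.subLattice s) (X.subWeyl s) (hX.subLattice_le_finPart s)
      ((hX.subWeyl_le_finiteWeyl s).trans hX.finiteWeyl_le_finIsoms)
      (fun _ hw _ hv => hX.map_mem_subLattice hw hv) := by
  apply le_antisymm
  · refine reflGroup_le fun α hα => ?_
    obtain ⟨S, hS, hα⟩ := Set.mem_iUnion₂.1 hα
    rcases hα with hα | ⟨γ, ⟨⟨w, hw, i, hi, rfl⟩, -⟩, rfl⟩
    · exact ⟨0, zero_mem _, _, refl_mem_reflGroup (Set.mem_biUnion hS hα),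
        by rw [tr_zero, one_mul]⟩
    · obtain ⟨w', hw', hbar⟩ := hX.exists_bar_map (s := s) (fun i hi => of_mem_component hS hi) hw
      have hf : X.form (w (X.simpleRoot i)) (w (X.simpleRoot i)) = X.gram i i := by
        rw [hX.form_map hw, form_simpleRoot]
      have hi0 := of_mem_component hS hi
      refine ⟨_, ?_, _, ?_, refl_tier_smul_delta_sub hX (hbar _ rfl).2
        (by rw [hf]; exact (hX.gram_self_pos i).ne') _⟩
      · rw [hf, bar_smul, bar_smul, (hbar _ rfl).1, ← map_smul, ← map_smul, ← bar_smul, ← bar_smul]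
        exact hX.map_mem_subLattice hw' (bar_coroot_mem_subLattice hi0)
      · rw [(hbar _ rfl).1]
        exact hX.refl_map_mem hw' (hX.refl_bar_mem_subWeyl hi0)
  · have key : X.subLattice s ≤ transLattice hX (X.subAffineWeyl s) := by
      refine (AddSubgroup.closure_le _).2 ?_
      rintro _ ⟨i, hi, rfl⟩
      obtain ⟨S, hS, hiS⟩ := exists_component hi
      have hS0 : ∀ i ∈ S, s i = 0 := fun i hi => of_mem_component hS hi
      have hpS : p ∉ S := fun h => hp (hS0 p h)
      obtain ⟨γ, m, hγ, hm, hγm, hlen⟩ := hX.exists_highest_component hp hS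
      have hγ2 := snd_of_mem_rootLike hγm
      have hγγ := form_self_of_mem_rootLike hγm
      refine hX.coroot_mem hpS hm hγm ((hX.isConn_component hS).reaches hm hγm)
        (N := (transLattice hX (X.subAffineWeyl s)).comap
          (X.barMap ∘ₗ ((X.tier : ℝ) • LinearMap.id)).toAddMonoidHom) ?_ ?_ hiS (hlen i hiS)
      · intro j hj v (hv : X.bar ((X.tier : ℝ) • v) ∈ transLattice hX (X.subAffineWeyl s))
        change X.bar ((X.tier : ℝ) • X.refl (X.simpleRoot j) v) ∈
          transLattice hX (X.subAffineWeyl s)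
        by_cases hk : (X.tier : ℝ) = 0
        · simpa [hk] using hv
        have hv2 : v.2 = 0 := by
          have := hv.1
          rw [bar_snd] at this
          simpa [hk] using this
        rw [bar_smul, hX.bar_refl rfl hv2, ← map_smul, ← bar_smul]
        exact hX.map_mem_transLattice (hX.refl_mem_isoms (by simp [bar_snd, simpleRoot_snd]))
          (subWeyl_le_subAffineWeyl s (hX.refl_bar_mem_subWeyl (hS0 j hj))) hv
      · change X.bar ((X.tier : ℝ) • (2 / m) • γ) ∈ transLattice hX (X.subAffineWeyl s)
        refine ⟨by simp [bar_snd, hγ2], ?_⟩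
        have h := refl_tier_smul_delta_sub hX hγ2 (by rw [hγγ]; exact hm.ne') X.tier
        rw [hγγ] at h
        rw [← mul_inv_eq_of_eq_mul h]
        refine mul_mem (refl_mem_reflGroup (Set.mem_biUnion hS (.inr ⟨γ, hγ, rfl⟩))) (inv_mem ?_)
        refine subWeyl_le_subAffineWeyl s ?_
        obtain ⟨w, hw, j, hj, rfl⟩ := hγ.1
        obtain ⟨w', hw', hbar⟩ := hX.exists_bar_map hS0 hw
        rw [(hbar _ rfl).1]
        exact hX.refl_map_mem hw' (hX.refl_bar_mem_subWeyl (hS0 j hj))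
    rintro _ ⟨v, hv, w, hw, rfl⟩
    exact mul_mem (key hv).2 (subWeyl_le_subAffineWeyl s hw)

/-! ### Finiteness of the finite Weyl group -/

theorem linearEquiv_ext {w w' : X.Space ≃ₗ[ℝ] X.Space}
    (h : ∀ i, w (X.simpleRoot i) = w' (X.simpleRoot i)) (h1 : w (0, 1) = w' (0, 1)) : w = w' := by
  ext1 x
  have hx : x = (∑ i, x.1 i • X.simpleRoot i) + x.2 • ((0, 1) : X.Space) := by
    have h2 : x = ((x.1, 0) : X.Space) + x.2 • ((0, 1) : X.Space) := by
      ext <;> simp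
    conv_lhs => rw [h2]
    rw [eq_sum_simpleRoot (x := ((x.1, 0) : X.Space)) rfl]
  rw [hx]
  simp only [map_add, map_sum, map_smul, h, h1]

/-- An element of `W_f` is determined by the images of `α_1, …, α_n`, because it fixes `δ` and
`ω_0`. -/
theorem HasTable.finite_finiteWeyl (hX : X.HasTable) : Finite X.finiteWeyl := by
  let R : {i : Fin (X.rank + 1) // i ≠ 0} → Set X.Space := fun i =>
    X.rootLike {i | i ≠ 0} (X.gram i i)
  have hR : (Set.univ.pi R).Finite :=
    Set.Finite.pi fun i => hX.finite_rootLike (S := {i | i ≠ 0}) (p := 0) (by simp) _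
  have := hR.to_subtype
  refine Finite.of_injective (fun w : X.finiteWeyl =>
    (⟨fun i => w.1 (X.simpleRoot i), fun i _ =>
      hX.map_mem_rootLike w.2 (simpleRoot_mem_rootLike i.2)⟩ : Set.univ.pi R)) ?_
  rintro ⟨w, hw⟩ ⟨w', hw'⟩ h
  have h1 : ∀ i, i ≠ 0 → w (X.simpleRoot i) = w' (X.simpleRoot i) := fun i hi =>
    congrFun (congrArg Subtype.val h) ⟨i, hi⟩
  have hf := hX.finiteWeyl_le_finIsoms hw
  have hf' := hX.finiteWeyl_le_finIsoms hw'
  refine Subtype.ext (linearEquiv_ext (fun i => ?_) (hf.2.trans hf'.2.symm))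
  by_cases hi : i = 0
  · subst hi
    have h2 : w X.delta = w' X.delta := hf.1.2.trans hf'.1.2.symm
    rw [delta, map_sum, map_sum,
      Fintype.sum_eq_add_sum_subtype_ne (fun i => w ((X.mark i : ℝ) • X.simpleRoot i)) 0,
      Fintype.sum_eq_add_sum_subtype_ne (fun i => w' ((X.mark i : ℝ) • X.simpleRoot i)) 0] at h2
    have h3 : ∀ i : {i : Fin (X.rank + 1) // i ≠ 0},
        w ((X.mark i : ℝ) • X.simpleRoot i) = w' ((X.mark i : ℝ) • X.simpleRoot i) := fun i => by
      rw [map_smul, map_smul, h1 i i.2]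
    rw [Finset.sum_congr rfl fun i _ => h3 i, add_left_inj, map_smul, map_smul] at h2
    exact smul_right_injective _ (hX.mark_ne 0) h2
  · exact h1 i hi

/-! ### The index in terms of the lattice of translations -/

/-- The factor `d_i` can be extracted from the row of `i`; what remains is the identity matrix with
the column of `p` (if `p ≠ 0`) replaced by `-b`. -/
theorem det_index_matrix {n : ℕ} (b : Fin (n + 1) → ℕ) (hb : b 0 = 1) (d : Fin (n + 1) → ℕ)
    (p : Fin (n + 1)) :
    (Matrix.of fun i j : {i : Fin (n + 1) // i ≠ 0} =>
      if j.1 = p then -((b i : ℤ) * d i) else if i = j then (d i : ℤ) else 0).det.natAbs =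
    b p * ∏ i : {i : Fin (n + 1) // i ≠ 0}, d i := by
  set B : Matrix {i : Fin (n + 1) // i ≠ 0} {i : Fin (n + 1) // i ≠ 0} ℤ :=
    Matrix.of fun i j => if j.1 = p then -(b i : ℤ) else if i = j then 1 else 0 with hB
  have h1 : (Matrix.of fun i j : {i : Fin (n + 1) // i ≠ 0} =>
      if j.1 = p then -((b i : ℤ) * d i) else if i = j then (d i : ℤ) else 0) =
      Matrix.diagonal (fun i : {i : Fin (n + 1) // i ≠ 0} => (d i : ℤ)) * B := by
    ext i j
    rw [Matrix.diagonal_mul]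
    simp only [hB, Matrix.of_apply]
    split_ifs <;> ring
  have h2 : B.det.natAbs = b p := by
    by_cases hp : p = 0
    · have : B = 1 := by
        ext i j
        have : j.1 ≠ p := hp ▸ j.2
        simp [hB, this, Matrix.one_apply]
      rw [this, Matrix.det_one, hp, hb]
      rfl
    · have : B = (1 : Matrix {i : Fin (n + 1) // i ≠ 0} {i : Fin (n + 1) // i ≠ 0} ℤ).updateCol
          ⟨p, hp⟩ (fun i => -(b i.1 : ℤ)) := by
        ext i j
        by_cases hj : j = ⟨p, hp⟩
        · subst hj
          simp [hB]
        · have : j.1 ≠ p := fun h => hj (Subtype.ext h)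
          simp [hB, this, Matrix.updateCol_ne hj, Matrix.one_apply]
      rw [this, ← Matrix.cramer_apply, Matrix.cramer_one]
      simp
  rw [h1, Matrix.det_mul, Matrix.det_diagonal, Int.natAbs_mul, h2, mul_comm, ← Nat.cast_prod,
    Int.natAbs_natCast]

theorem HasTable.bar_coroot_zero_eq (hX : X.HasTable) : X.bar (X.coroot 0) = -X.theta := by
  have h := hX.mark_ne 0
  rw [coroot, bar_smul, hX.bar_simpleRoot_zero, hX.two_div_gram_self, hX.comark_zero]
  match_scalars
  field_simp

/-- The vectors `μ_i α_i^∨`, `i ≠ 0`, form a basis of the lattice of translations of the affine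
Weyl group, and the translation by `k α_i^∨` is the `d_i`-th power of the one by `μ_i α_i^∨`. The
fields are what is to be checked for this: the lattice is invariant under the finite Weyl group
(`int`), it contains `θ^∨ = θ / a_0` (`theta`), and the group contains its translations (`mem`). -/
structure IsTransScaling (hX : X.HasTable) (μ : Fin (X.rank + 1) → ℝ)
    (d : Fin (X.rank + 1) → ℕ) : Prop where
  d_ne_zero : ∀ i, d i ≠ 0
  ne_zero : ∀ i, μ i ≠ 0
  mul_eq : ∀ i, d i * μ i = X.tier
  int : ∀ i j, ∃ z : ℤ, μ i * X.cartan i j = z * μ j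
  theta : ∀ i, i ≠ 0 → ∃ q : ℤ, (X.comark i : ℝ) = q * (X.mark 0 * μ i)
  mem : ∀ i, i ≠ 0 → μ i • X.coroot i ∈ transLattice hX X.affineWeyl

/-- Both groups are semidirect products, so the index is that of the lattices of translations times
that of the linear parts. Modulo `δ`, the lattice of the subgroup is spanned by the `k α_i^∨`,
`i ≠ p`; since `α_0^∨` is minus the sum of the `a_i^∨ α_i^∨`, `i ≠ 0`, the determinant of this basis
is `a_p^∨ ∏ d_i`. -/
theorem IsTransScaling.relIndex_subAffineWeyl {hX : X.HasTable} {μ : Fin (X.rank + 1) → ℝ}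
    {d : Fin (X.rank + 1) → ℕ} (h : IsTransScaling hX μ d) {s : Fin (X.rank + 1) → ℕ}
    {p : Fin (X.rank + 1)} (hp : ∀ i, s i = 0 ↔ i ≠ p) :
    X.subAffineWeyl s ≤ X.affineWeyl ∧
    (X.subAffineWeyl s).relIndex X.affineWeyl =
      X.comark p * (∏ i : {i : Fin (X.rank + 1) // i ≠ 0}, d i) *
        (X.subWeyl s).relIndex X.finiteWeyl := by
  obtain ⟨hd0, hμ, hd, hint, hq, hM⟩ := h
  let u : {i : Fin (X.rank + 1) // i ≠ 0} → X.Space := fun i => μ i • X.coroot i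
  have hu : ∀ i, u i ∈ X.finPart := fun i => by
    have h := coroot_mem_finPart i.2
    exact ⟨by simp [u, h.1], by simp [u, h.2]⟩
  set N := AddSubgroup.closure (Set.range u) with hNdef
  have huN : ∀ i, u i ∈ N := fun i => AddSubgroup.subset_closure (Set.mem_range_self i)
  have hN : N ≤ X.finPart := (AddSubgroup.closure_le _).2 (by rintro _ ⟨i, rfl⟩; exact hu i)
  have hWN : ∀ w ∈ X.finiteWeyl, ∀ v ∈ N, w v ∈ N := fun w hw v hv => by
    refine map_mem_of_refl_mem (S := {i | i ≠ 0}) (N := N) (fun j hj v hv => ?_) hw hv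
    induction hv using AddSubgroup.closure_induction with
    | mem x h =>
      obtain ⟨i, rfl⟩ := h
      obtain ⟨z, hz⟩ := hint i j
      have : X.refl (X.simpleRoot j) (u i) = u i - z • u ⟨j, hj⟩ := by
        simp only [u]
        rw [map_smul, hX.refl_coroot, smul_sub, ← Int.cast_smul_eq_zsmul ℝ,
          ← Int.cast_smul_eq_zsmul ℝ, smul_smul, smul_smul, hz]
      rw [this]
      exact sub_mem (huN i) (zsmul_mem (huN _) _)
    | zero => rw [map_zero]; exact zero_mem _
    | add x y _ _ hx hy => rw [map_add]; exact add_mem hx hy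
    | neg x _ hx => rw [map_neg]; exact neg_mem hx
  have hθ : (1 / X.mark 0 : ℝ) • X.theta ∈ N := by
    have h := hX.bar_coroot_zero
    rw [hX.bar_coroot_zero_eq, neg_inj] at h
    rw [h, Finset.smul_sum]
    refine sum_mem fun i _ => ?_
    obtain ⟨q, hq⟩ := hq i i.2
    have h0 := hX.mark_ne 0
    have : (1 / X.mark 0 : ℝ) • (X.comark i : ℤ) • X.coroot i = q • u i := by
      simp only [u]
      rw [← Int.cast_smul_eq_zsmul ℝ, ← Int.cast_smul_eq_zsmul ℝ, smul_smul, smul_smul,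
        Int.cast_natCast, hq]
      congr 1
      field_simp
    rw [this]
    exact zsmul_mem (huN i) _
  have hNW : ∀ v ∈ N, tr hX v ∈ X.affineWeyl := fun v hv => by
    have : N ≤ transLattice hX X.affineWeyl :=
      (AddSubgroup.closure_le _).2 (by rintro _ ⟨i, rfl⟩; exact hM i i.2)
    exact (this hv).2
  -- the column of `p` stands for `α_0`, which replaces `α_p`
  let A : Matrix {i : Fin (X.rank + 1) // i ≠ 0} {i : Fin (X.rank + 1) // i ≠ 0} ℤ :=
    Matrix.of fun i j => if j.1 = p then -((X.comark i : ℤ) * d i) else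
      if i = j then (d i : ℤ) else 0
  have hdu : ∀ i, (d i.1 : ℤ) • u i = (X.tier : ℝ) • X.coroot i := fun i => by
    simp only [u]
    rw [← Int.cast_smul_eq_zsmul ℝ, smul_smul, Int.cast_natCast, hd]
  have hcol : ∀ j, ∑ i, A i j • u i =
      X.bar ((X.tier : ℝ) • X.coroot (if j.1 = p then 0 else j.1)) := fun j => by
    by_cases hj : j.1 = p
    · simp only [A, Matrix.of_apply, hj, if_true]
      rw [bar_smul, hX.bar_coroot_zero, smul_neg, Finset.smul_sum, ← Finset.sum_neg_distrib]
      refine Finset.sum_congr rfl fun i _ => ?_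
      rw [neg_smul, mul_smul, hdu, smul_comm]
    · simp only [A, Matrix.of_apply, hj, if_false, ite_smul, zero_smul, Finset.sum_ite_eq',
        Finset.mem_univ, if_true]
      rw [hdu, bar_smul, bar_of_mem (coroot_mem_finPart j.2)]
  have hsub : X.subLattice s =
      AddSubgroup.closure (Set.range fun j => ∑ i, A i j • u i) := by
    rw [subLattice]
    congr 1
    ext v
    simp only [Set.mem_ofPred_eq, Set.mem_range, hcol]
    constructor
    · rintro ⟨i, hi, rfl⟩
      rw [hp] at hi
      by_cases h0 : i = 0
      · subst h0
        exact ⟨⟨p, hi.symm⟩, by simp⟩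
      · exact ⟨⟨i, h0⟩, by simp [hi]⟩
    · rintro ⟨j, rfl⟩
      refine ⟨_, (hp _).2 ?_, rfl⟩
      split_ifs with h
      · rw [← h]
        exact j.2.symm
      · exact h
  have hsubN : X.subLattice s ≤ N := by
    rw [hsub]
    refine (AddSubgroup.closure_le _).2 ?_
    rintro _ ⟨j, rfl⟩
    exact sum_mem fun i _ => zsmul_mem (huN i) _
  have hdet : A.det.natAbs = X.comark p * ∏ i : {i : Fin (X.rank + 1) // i ≠ 0}, d i :=
    det_index_matrix X.comark hX.comark_zero d p
  have hdet0 : A.det ≠ 0 := by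
    rw [← Int.natAbs_ne_zero, hdet]
    exact mul_ne_zero (hX.comark_pos p).ne' (Finset.prod_ne_zero_iff.2 fun i _ => hd0 i)
  have hli : LinearIndependent ℝ u := by
    rw [Fintype.linearIndependent_iff]
    intro c hc i
    have h := congrArg (fun x : X.Space => x.1 i) hc
    have hg := (hX.gram_self_pos i).ne'
    simp only [u, coroot, simpleRoot, Prod.fst_sum, Prod.smul_fst, Finset.sum_apply, Pi.smul_apply,
      smul_eq_mul, Pi.single_apply, Prod.fst_zero, Pi.zero_apply] at h
    rw [Finset.sum_eq_single i (fun j _ hji => by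
      rw [if_neg fun e => hji (Subtype.ext e.symm)]; ring) (by simp)] at h
    simpa [hμ i, hg] using h
  have hps : s p ≠ 0 := fun h => (hp p).1 h rfl
  have e1 := hX.affineWeyl_eq_semi hN hWN hθ hNW
  have e2 := hX.subAffineWeyl_eq_semi hps
  refine ⟨?_, ?_⟩
  · rw [e1, e2]
    rintro _ ⟨v, hv, w, hw, rfl⟩
    exact ⟨v, hsubN hv, w, hX.subWeyl_le_finiteWeyl s hw, rfl⟩
  · rw [e1, e2, relIndex_semi hX hN hX.finiteWeyl_le_finIsoms hWN hsubN
      (hX.subWeyl_le_finiteWeyl s) (fun _ hw _ hv => hX.map_mem_subLattice hw hv)]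
    rw [hsub, relIndex_transGroup hX u hu hli A hdet0, hdet]

/-! ### Long roots -/

theorem simpleRoot_mem_realRoots (i) : X.simpleRoot i ∈ X.realRoots := ⟨1, one_mem _, i, rfl⟩

theorem HasTable.exists_form_eq (hX : X.HasTable) {β : X.Space} (hβ : β ∈ X.realRoots) :
    ∃ i, X.form β β = X.gram i i := by
  obtain ⟨w, hw, i, rfl⟩ := hβ
  exact ⟨i, by rw [hX.form_map hw, form_simpleRoot]⟩

theorem HasTable.isLong_iff (hX : X.HasTable) (i) :
    X.IsLong (X.simpleRoot i) ↔ ∀ j, X.gram j j ≤ X.gram i i := by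
  constructor
  · intro h j
    simpa only [form_simpleRoot] using h.2 _ (simpleRoot_mem_realRoots j)
  · refine fun h => ⟨simpleRoot_mem_realRoots i, fun β hβ => ?_⟩
    obtain ⟨j, hj⟩ := hX.exists_form_eq hβ
    rw [hj, form_simpleRoot]
    exact h j

theorem HasTable.form_of_isOfMinLength (hX : X.HasTable) {β : X.Space} (hβ : X.IsOfMinLength β)
    {i} (hi : ∀ j, X.gram i i ≤ X.gram j j) : X.form β β = X.gram i i := by
  obtain ⟨j, hj⟩ := hX.exists_form_eq hβ.1
  refine le_antisymm ?_ (hj ▸ hi j)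
  simpa only [form_simpleRoot] using hβ.2 _ (simpleRoot_mem_realRoots i)

theorem numLong_eq_card [DecidablePred fun i => X.IsLong (X.simpleRoot i)] :
    X.numLong = (Finset.univ.filter fun i : {i : Fin (X.rank + 1) // i ≠ 0} =>
      X.IsLong (X.simpleRoot i)).card := by
  rw [numLong, ← Set.ncard_coe_finset, ← Set.ncard_image_of_injective _ Subtype.val_injective]
  congr 1
  ext i
  simp [and_comm]

/-- Coprime coefficients of which only one is nonzero. -/
theorem eq_one_of_gcd {s : Fin (X.rank + 1) → ℕ} {p} (hcop : Finset.univ.gcd s = 1)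
    (hp : ∀ i, s i = 0 ↔ i ≠ p) : s p = 1 := by
  rw [← Nat.dvd_one, ← hcop]
  refine Finset.dvd_gcd fun i _ => ?_
  by_cases h : i = p
  · rw [h]
  · rw [(hp i).2 h]
    exact dvd_zero _

/-! ### The lattice of translations -/

/-- The lattice of translations in the three cases of `length_cases`, and the values of the factor
`r_p` and of the determinant that result. -/
theorem HasTable.exists_isTransScaling (hX : X.HasTable) {p : Fin (X.rank + 1)}
    (hkp : X.tier * X.mark p = 2) :
    (∃ μ d, IsTransScaling hX μ d ∧
      X.comark p * (∏ i : {i : Fin (X.rank + 1) // i ≠ 0}, d i) =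
        X.lengthFactor p * X.tier ^ (X.rank - X.numLong)) ∧
      ((∃ i, ¬ X.IsLong (X.simpleRoot i)) → X ≠ G2 →
        ∃ i, (∀ j, X.gram i i ≤ X.gram j j) ∧
          (X.lengthFactor p : ℝ) = X.gram p p / X.gram i i) := by
  classical
  have hcard : Fintype.card {i : Fin (X.rank + 1) // i ≠ 0} = X.rank := by simp
  have hg0 := hX.gram_self 0
  rw [hX.comark_zero] at hg0
  have hpos := hX.comark_pos p
  rcases length_cases X hkp with ⟨hk, hm0, hle, hlen⟩ | ⟨hk, hm0, hlen, l, hl0, hl⟩ |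
      ⟨hk, hm0, hp0, hmp, hb, hm⟩
  · -- `k = 1`: `θ` is a long root, and the translations are those of the coroot lattice. The label
    -- of `α_p` is `2`, so that `(α_p, α_p) = a_p^∨`.
    have hmp : X.mark p = 2 := by rw [hk] at hkp; omega
    rw [hm0] at hg0
    have hgle : ∀ j, X.gram j j ≤ 2 := fun j => by
      rw [hX.gram_self, div_le_iff₀ (hX.mark_pos' j)]
      have : (X.comark j : ℝ) ≤ X.mark j := by exact_mod_cast hle j
      linarith
    have hgp : X.gram p p = X.comark p := by rw [hX.gram_self, hmp]; push_cast; ring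
    have hr : X.lengthFactor p = X.comark p := by
      have hlp := hle p
      have h : X.comark p = 1 ∨ X.comark p = 2 := by omega
      rw [lengthFactor, hm0]
      rcases h with h | h
      · rw [if_neg, h]
        rw [hX.isLong_iff, hgp, h]
        intro h'
        have := h' 0
        norm_num [hg0] at this
      · rw [if_pos, h]
        rw [hX.isLong_iff, hgp, h]
        exact_mod_cast hgle
    refine ⟨⟨fun _ => 1, fun _ => 1, ⟨by simp, by simp, by simp [hk],
      fun i j => ⟨X.cartan i j, by simp⟩, fun i _ => ⟨X.comark i, by simp [hm0]⟩, fun i hi => ?_⟩,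
      by simp [hk, hr]⟩, ?_⟩
    · rw [one_smul]
      exact hX.coroot_mem_transLattice hi (by simpa [hm0] using hgle i)
    · -- for `G_2^(1)`, the quotient of the squared lengths would be `3`
      rintro ⟨i, hi⟩ hG
      have h12 : ∀ j, X.gram j j = 2 ∨ X.gram j j = 1 := fun j => by
        have hb := (hX.comark_pos' j).ne'
        rw [hX.gram_self]
        rcases hlen hG j with h | h
        · rw [← h]
          left
          field_simp
        · rw [← h]
          right
          push_cast
          field_simp
      have h1 : X.gram i i = 1 := (h12 i).resolve_left fun h => hi ((hX.isLong_iff i).2 (by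
        rw [h]; exact hgle))
      refine ⟨i, fun j => ?_, by rw [h1, hgp, hr, div_one]⟩
      rw [h1]
      rcases h12 j with h | h <;> norm_num [h]
  · -- `k = 2`, `a_0 = 1`: `θ` is a short root, and the translations are those of the root lattice,
    -- with basis `α_i = ((α_i, α_i) / 2) α_i^∨`. The label of `α_p` is `1`, so that
    -- `(α_p, α_p) = 2 a_p^∨`.
    have hmp : X.mark p = 1 := by rw [hk] at hkp; omega
    rw [hm0] at hg0
    have h24 : ∀ j, (X.comark j = X.mark j ∧ X.gram j j = 2) ∨
        (X.comark j = 2 * X.mark j ∧ X.gram j j = 4) := fun j => by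
      have ha := hX.mark_ne j
      rcases hlen j with h | h
      · left
        refine ⟨h, ?_⟩
        rw [hX.gram_self, h]
        field_simp
      · right
        refine ⟨h, ?_⟩
        rw [hX.gram_self, h]
        push_cast
        field_simp
        norm_num
    have hlong : ∀ j, X.IsLong (X.simpleRoot j) ↔ X.comark j = 2 * X.mark j := fun j => by
      rw [hX.isLong_iff]
      have ha := hX.mark_pos j
      constructor
      · intro h
        have h1 := h l
        rcases h24 l with ⟨h2, h3⟩ | ⟨h2, h3⟩
        · have := hX.mark_pos l
          omega
        rcases h24 j with ⟨h4, h5⟩ | ⟨h4, h5⟩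
        · norm_num [h3, h5] at h1
        · exact h4
      · intro h i
        rcases h24 j with ⟨h4, h5⟩ | ⟨h4, h5⟩
        · omega
        rcases h24 i with ⟨h6, h7⟩ | ⟨h6, h7⟩ <;> norm_num [h5, h7]
    have hr : X.lengthFactor p = X.comark p := by
      rw [lengthFactor, hm0, hlong, hmp]
      rcases h24 p with ⟨h, -⟩ | ⟨h, -⟩ <;> simp [h, hmp]
    have hgpos := fun i => (hX.gram_self_pos i).ne'
    refine ⟨⟨fun i => X.gram i i / 2, fun i => if X.IsLong (X.simpleRoot i) then 1 else 2,
      ⟨fun i => by split_ifs <;> norm_num, fun i => by simpa using hgpos i, fun i => ?_,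
      fun i j => ⟨X.cartan j i, ?_⟩, fun i _ => ⟨X.mark i, ?_⟩, fun i hi => ?_⟩, ?_⟩, ?_⟩
    · have := hX.mark_pos i
      rcases h24 i with ⟨h, h'⟩ | ⟨h, h'⟩
      · rw [if_neg (by rw [hlong]; omega), h', hk]
        norm_num
      · rw [if_pos ((hlong i).2 h), h', hk]
        norm_num
    · linear_combination (hX.gram_self_mul_cartan i j - hX.gram_self_mul_cartan j i) / 2 +
        hX.gram_symm i j
    · have := hX.mark_ne i
      rw [hX.gram_self, hm0]
      push_cast
      field_simp
    · have : (X.gram i i / 2) • X.coroot i = X.simpleRoot i := by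
        have := hgpos i
        rw [coroot, smul_smul]
        field_simp
        exact one_smul _ _
      rw [this]
      refine hX.simpleRoot_mem_transLattice hm0 hi ?_
      rcases h24 i with ⟨-, h⟩ | ⟨-, h⟩ <;> norm_num [h]
    · rw [hr, hk, Finset.prod_ite, Finset.prod_const_one, Finset.prod_const, one_mul]
      congr 2
      have := Finset.card_filter_add_card_filter_not (s := Finset.univ)
        (fun i : {i : Fin (X.rank + 1) // i ≠ 0} => X.IsLong (X.simpleRoot i))
      rw [Finset.card_univ, hcard, ← numLong_eq_card] at this
      omega
    · intro _ _
      refine ⟨0, fun j => ?_, ?_⟩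
      · rcases h24 j with ⟨-, h⟩ | ⟨-, h⟩ <;> norm_num [h, hg0]
      · rw [hr, hX.gram_self, hmp, hg0]
        push_cast
        field_simp
  · -- `A_{2n}^(2)`: `α_p` is the only long simple root, `(θ, θ) = 4` is the maximal squared length,
    -- and the translations are those of the coroot lattice, although `k = 2`
    rw [hm0] at hg0
    have hg : ∀ j, j ≠ 0 → j ≠ p → X.gram j j = 2 := fun j h0 hjp => by
      rw [hX.gram_self, hb j h0, hm j h0 hjp]
      norm_num
    have hgp : X.gram p p = 4 := by
      rw [hX.gram_self, hb p hp0, hmp]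
      norm_num
    norm_num at hg0
    have hlong : ∀ j, X.IsLong (X.simpleRoot j) ↔ j = p := fun j => by
      rw [hX.isLong_iff]
      constructor
      · intro h
        by_contra hjp
        have h1 := h p
        by_cases h0 : j = 0
        · norm_num [h0, hg0, hgp] at h1
        · norm_num [hg j h0 hjp, hgp] at h1
      · rintro rfl i
        by_cases h0 : i = 0
        · norm_num [h0, hg0, hgp]
        by_cases hij : i = j
        · rw [hij]
        · norm_num [hg i h0 hij, hgp]
    have hr : X.lengthFactor p = 4 := by
      rw [lengthFactor, if_pos ((hlong p).2 rfl), hm0]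
    have hL : X.numLong = 1 := by
      rw [numLong, Set.ncard_eq_one]
      refine ⟨p, ?_⟩
      ext i
      simp only [hlong, Set.mem_ofPred_eq, Set.mem_singleton_iff]
      exact ⟨fun h => h.2, fun h => ⟨h ▸ hp0, h⟩⟩
    refine ⟨⟨fun _ => 1, fun _ => 2, ⟨by simp, by simp, by simp [hk],
      fun i j => ⟨X.cartan i j, by simp⟩, fun i hi => ⟨1, by simp [hm0, hb i hi]⟩,
      fun i hi => ?_⟩, ?_⟩, ?_⟩
    · rw [one_smul]
      refine hX.coroot_mem_transLattice hi ?_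
      by_cases hip : i = p
      · norm_num [hip, hgp, hm0]
      · norm_num [hg i hi hip, hm0]
    · rw [Finset.prod_const, Finset.card_univ, hcard, hr, hL, hk, hb p hp0]
      have : X.rank = X.rank - 1 + 1 := by
        have := p.2
        have h0 : p.val ≠ 0 := fun h => hp0 (Fin.ext h)
        omega
      rw [this, pow_succ, Nat.add_sub_cancel]
      ring
    · intro _ _
      refine ⟨0, fun j => ?_, by rw [hr, hgp, hg0]; norm_num⟩
      by_cases h0 : j = 0
      · rw [h0]
      by_cases hjp : j = p
      · norm_num [hjp, hgp, hg0]
      · norm_num [hg j h0 hjp, hg0]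

end

end AffineType

theorem proposition5p3 (X : AffineType) (s : Fin (X.rank + 1) → ℕ)
    (hcop : Finset.univ.gcd s = 1)
    (horder : X.tier * ∑ i, X.mark i * s i = 2)
    (p : Fin (X.rank + 1)) (hp : ∀ i, s i = 0 ↔ i ≠ p) :
    X.subAffineWeyl s ≤ X.affineWeyl ∧
    X.subWeyl s ≤ X.finiteWeyl ∧
    (X.subWeyl s).relIndex X.finiteWeyl ≠ 0 ∧
    (X.subAffineWeyl s).relIndex X.affineWeyl =
      X.lengthFactor p * X.tier ^ (X.rank - X.numLong) *
        (X.subWeyl s).relIndex X.finiteWeyl ∧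
    ((∃ α ∈ X.realRoots, ¬ X.IsLong α) → X ≠ AffineType.G2 →
      ∀ β, X.IsOfMinLength β →
        (X.lengthFactor p : ℝ) =
          X.form (X.simpleRoot p) (X.simpleRoot p) / X.form β β) := by
  have hsp : s p = 1 := AffineType.eq_one_of_gcd hcop hp
  have hkp : X.tier * X.mark p = 2 := by
    rwa [Finset.sum_eq_single p (fun i _ hi => by rw [(hp i).2 hi, mul_zero]) (by simp), hsp,
      mul_one] at horder
  have hX : X.HasTable := AffineType.isAffineTable_of_tier_mul_mark X hkp
  obtain ⟨⟨μ, d, hμ, hdet⟩, hlen⟩ := hX.exists_isTransScaling hkp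
  obtain ⟨hle, hindex⟩ := hμ.relIndex_subAffineWeyl hp
  refine ⟨hle, hX.subWeyl_le_finiteWeyl s, fun h => ?_, by rw [hindex, hdet], ?_⟩
  · have := hX.finite_finiteWeyl
    have h1 := Subgroup.relIndex_dvd_card (X.subWeyl s) X.finiteWeyl
    rw [h, zero_dvd_iff] at h1
    exact Nat.card_pos.ne' h1
  · rintro ⟨α, ⟨w, hw, i, rfl⟩, hα⟩ hG β hβ
    obtain ⟨j, hj, hj'⟩ := hlen ⟨i, fun h => hα ⟨⟨w, hw, i, rfl⟩, fun β hβ => by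
      rw [hX.form_map hw]
      exact h.2 β hβ⟩⟩ hG
    rw [hX.form_of_isOfMinLength hβ hj, AffineType.form_simpleRoot, hj']
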